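/- **Definitions.** An index is a finite tuple $\boldsymbol k=(k_1,\dots,k_r)$ of positive integers; it is admissible if $r=0$ or $k_r\ge 2$. *The case $\mathcal F=\mathcal A$.* For a positive integer $n$ let $\mathcal A_n=\prod_p \mathbb Z/p^n\mathbb Z\big/\bigoplus_p\mathbb Z/p^n\mathbb Z$ ($p$ running over all primes), a $\mathbb Q$-algebra via $q\mapsto (q \bmod p^n)_p$, and put $$\zeta_{\mathcal A_n}(\boldsymbol k)=\Bigl(\sum_{0<n_1<\cdots<n_r<p}\frac1{n_1^{k_1}\cdots n_r^{k_r}}\bmod p^n\Bigr)_p,\qquad \zeta^\star_{\mathcal A_n}(\boldsymbol k)=\Bigl(\sum_{1\le n_1\le\cdots\le n_r\le p-1}\frac1{n_1^{k_1}\cdots n_r^{k_r}}\bmod p^n\Bigr)_p .$$ For $k\ge 2$ put $\mathfrak Z_{\mathcal A_n}(k)=\bigl(\frac{B_{p^{n-1}(p-1)-k+1}}{k-1+p^{n-1}}\bmod p^n\bigr)_p\in\mathcal A_n$, where $B_j$ is the $j$-th Bernoulli number; in particular $\mathfrak Z_{\mathcal A_1}(k)=(B_{p-k}/k \bmod p)_p$.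 (Finitely many primes may be ignored.) *The case $\mathcal F=\mathcal S$.* Let $\zeta(\boldsymbol k)=\sum_{0<n_1<\cdots<n_r}n_1^{-k_1}\cdots n_r^{-k_r}$ for admissible $\boldsymbol k$ (with $\zeta(\varnothing)=1$), let $\mathcal Z\subset\mathbb R$ be the $\mathbb Q$-subalgebra generated by all these values, and $\overline{\mathcal Z}=\mathcal Z/\zeta(2)\mathcal Z$. Let $\mathfrak H^1$ be the $\mathbb Q$-vector space with basis the words $e_{\boldsymbol k}=e_{k_1}\cdots e_{k_r}$ over all indices, with the bilinear harmonic product given by $w*1=1*w=w$ and $e_aw*e_bw'=e_a(w*e_bw')+e_b(e_aw*w')+e_{a+b}(w*w')$, and let $\mathfrak H^0$ be the span of the $e_{\boldsymbol k}$ with $\boldsymbol k$ admissible. Every $x\in\mathfrak H^1$ is uniquely of the form $x=\sum_i x_i*e_1^{*i}$ with $x_i\in\mathfrak H^0$; put $\mathrm{reg}_*(x)=x_0$ and $\zeta^*(\boldsymbol k)=Z(\mathrm{reg}_*(e_{\boldsymbol k}))\in\mathcal Z$, where $Z:\mathfrak H^0\to\mathcal Z$ is linear with $Z(e_{\boldsymbol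 k})=\zeta(\boldsymbol k)$. Let $\zeta_{\widehat{\mathcal S}}(\boldsymbol k)\in\overline{\mathcal Z}[[t]]$ be the reduction modulo $\zeta(2)$ of $$\sum_{i=0}^r(-1)^{k_{i+1}+\cdots+k_r}\zeta^*(k_1,\dots,k_i)\sum_{l_{i+1},\dots,l_r\ge0}\Bigl[\prod_{j=i+1}^r\binom{k_j+l_j-1}{l_j}\Bigr]\zeta^*(k_r+l_r,\dots,k_{i+1}+l_{i+1})\,t^{l_{i+1}+\cdots+l_r},$$ and let $\zeta^\star_{\widehat{\mathcal S}}(\boldsymbol k)=\sum\zeta_{\widehat{\mathcal S}}(k_1\square\cdots\square k_r)$, the sum being over all ways to replace each $\square$ by a comma or a plus sign. Let $\zeta_{\mathcal S_n}(\boldsymbol k)$, $\zeta^\star_{\mathcal S_n}(\boldsymbol k)$ be their images in $\overline{\mathcal Z}[[t]]/(t^n)$, and for $k\ge2$ let $\mathfrak Z_{\mathcal S_n}(k)$ be the class of $\zeta(k)$ in $\overline{\mathcal Z}[[t]]/(t^n)$. **Theorem.** Let $k_1,k_2,k_3$ be positive integers such that $k=k_1+k_2+k_3$ is odd. Then, for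 both $\mathcal F=\mathcal A$ and $\mathcal F=\mathcal S$, $$\zeta_{\mathcal F_1}(k_1,k_2,k_3)=-\zeta^\star_{\mathcal F_1}(k_1,k_2,k_3)=\frac12\left\{(-1)^{k_1}\binom{k}{k_1}-(-1)^{k_3}\binom{k}{k_3}\right\}\mathfrak Z_{\mathcal F_1}(k).$$ -/

import Mathlib

open scoped BigOperators

noncomputable section

namespace FiniteMZV

/-! ### Indices -/

/-- An index is a finite (possibly empty) tuple of positive integers. -/
abbrev Index := List ℕ+

/-- An index is admissible if it is empty or its last entry is at least `2`. -/
def Admissible (k : Index) : Prop := ∀ a ∈ k.getLast?, 2 ≤ a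

/-- The list of all indices `k₁ □ ⋯ □ kᵣ`, where every `□` is either a comma or a plus. -/
def contractions : Index → List Index
  | [] => [[]]
  | [a] => [[a]]
  | a :: b :: t => (contractions (b :: t)).map (fun s => a :: s) ++ contractions ((a + b) :: t)
termination_by k => k.length

/-! ### The ring `𝒜ₙ` and the `𝒜ₙ`-multiple zeta(-star) values -/

/-- The ideal `⨁ₚ ℤ/pⁿℤ` of `∏ₚ ℤ/pⁿℤ`: the families with only finitely many nonzero entries. -/
def finsuppIdeal (n : ℕ) : Ideal (∀ p : Nat.Primes, ZMod ((p : ℕ) ^ n)) where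
  carrier := {f | {p | f p ≠ 0}.Finite}
  zero_mem' := by simp
  add_mem' := by
    intro f g hf hg
    refine (hf.union hg).subset ?_
    intro p hp
    by_contra h
    simp only [Set.mem_union, Set.mem_ofPred_eq, not_or, not_not] at h
    exact hp (by simp [h.1, h.2])
  smul_mem' := by
    intro c f hf
    refine hf.subset ?_
    intro p hp h
    exact hp (by simp [h])

/-- `𝒜ₙ = ∏ₚ ℤ/pⁿℤ / ⨁ₚ ℤ/pⁿℤ`. -/
abbrev ARing (n : ℕ) : Type := (∀ p : Nat.Primes, ZMod ((p : ℕ) ^ n)) ⧸ finsuppIdeal n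

/-- The class in `𝒜ₙ` of a family of residues. -/
def toA (n : ℕ) (f : ∀ p : Nat.Primes, ZMod ((p : ℕ) ^ n)) : ARing n :=
  Ideal.Quotient.mk (finsuppIdeal n) f

/-- Reduction of a rational number `q` modulo `m`
(meaningful when the denominator of `q` is prime to `m`). -/
def ratMod (m : ℕ) (q : ℚ) : ZMod m := (q.num : ZMod m) * (q.den : ZMod m)⁻¹

theorem toA_eq_of_dvd {n : ℕ} {f g : ∀ p : Nat.Primes, ZMod ((p : ℕ) ^ n)} (N : ℕ) (hN : N ≠ 0)
    (h : ∀ p : Nat.Primes, ¬ (p : ℕ) ∣ N → f p = g p) : toA n f = toA n g := by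
  refine Ideal.Quotient.eq.2 ?_
  change {p : Nat.Primes | (f - g) p ≠ 0}.Finite
  refine Set.Finite.of_finite_image (f := fun p : Nat.Primes => (p : ℕ))
    ((Set.finite_Iic N).subset ?_) (fun a _ b _ hab => Subtype.ext hab)
  rintro _ ⟨p, hp, rfl⟩
  by_contra hlt
  refine hp ?_
  have : ¬ (p : ℕ) ∣ N := fun hd => hlt (Nat.le_of_dvd (Nat.pos_of_ne_zero hN) hd)
  simp [h p this]

theorem ratMod_eq {m : ℕ} {q : ℚ} {a b : ℤ} (hq : IsUnit (q.den : ZMod m))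
    (hb : IsUnit (b : ZMod m)) (h : q.num * b = a * q.den) :
    ratMod m q = (a : ZMod m) * (b : ZMod m)⁻¹ := by
  have h' : (q.num : ZMod m) * b = a * q.den := by exact_mod_cast congrArg (Int.cast : ℤ → ZMod m) h
  unfold ratMod
  have e1 := ZMod.mul_inv_of_unit _ hq
  have e2 := ZMod.mul_inv_of_unit _ hb
  calc (q.num : ZMod m) * (q.den : ZMod m)⁻¹
      = ((q.num : ZMod m) * b) * (b : ZMod m)⁻¹ * (q.den : ZMod m)⁻¹ := by
        rw [mul_assoc (q.num : ZMod m), e2, mul_one]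
    _ = a * (b : ZMod m)⁻¹ * ((q.den : ZMod m) * (q.den : ZMod m)⁻¹) := by rw [h']; ring
    _ = _ := by rw [e1, mul_one]

theorem isUnit_of_not_dvd {p n d : ℕ} (hp : p.Prime) (h : ¬ p ∣ d) :
    IsUnit (d : ZMod (p ^ n)) :=
  (ZMod.isUnit_iff_coprime d (p ^ n)).2 (((Nat.Prime.coprime_iff_not_dvd hp).2 h).symm.pow_right n)

/-- The structure map `ℚ → 𝒜ₙ`, `q ↦ (q mod pⁿ)ₚ`. -/
def ratToA (n : ℕ) : ℚ →+* ARing n where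
  toFun q := toA n fun p => ratMod ((p : ℕ) ^ n) q
  map_one' := by
    have : (fun p : Nat.Primes => ratMod ((p : ℕ) ^ n) 1) = 1 := by
      funext p; simp [ratMod]
    rw [this]; rfl
  map_zero' := by
    have : (fun p : Nat.Primes => ratMod ((p : ℕ) ^ n) 0) = 0 := by
      funext p; simp [ratMod]
    rw [this]; rfl
  map_mul' x y := by
    change _ = toA n (_ * _)
    refine toA_eq_of_dvd (x.den * y.den * (x * y).den) (by positivity) fun p hp => ?_
    have h12 : ¬ (p : ℕ) ∣ x.den * y.den := fun h => hp (h.mul_right _)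
    have h3 := isUnit_of_not_dvd (n := n) p.2 fun h : (p : ℕ) ∣ (x * y).den => hp (h.mul_left _)
    have h1 := isUnit_of_not_dvd (n := n) p.2 fun h : (p : ℕ) ∣ x.den => h12 (h.mul_right _)
    have h2 := isUnit_of_not_dvd (n := n) p.2 fun h : (p : ℕ) ∣ y.den => h12 (h.mul_left _)
    have hb : IsUnit (((x.den * y.den : ℕ) : ℤ) : ZMod ((p : ℕ) ^ n)) := by
      push_cast; exact h1.mul h2
    rw [ratMod_eq (a := x.num * y.num) (b := ((x.den * y.den : ℕ) : ℤ)) h3 hb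
      (by push_cast; rw [← mul_assoc]; exact Rat.mul_num_den' x y)]
    have e1 := ZMod.mul_inv_of_unit _ h1
    have e2 := ZMod.mul_inv_of_unit _ h2
    have e3 := ZMod.mul_inv_of_unit _ hb
    push_cast at e3 ⊢
    simp only [Pi.mul_apply, ratMod]
    refine (hb.mul_left_inj).1 ?_
    push_cast
    linear_combination ((x.num : ZMod ((p : ℕ) ^ n)) * y.num) * e3
      - ((x.num : ZMod ((p : ℕ) ^ n)) * y.num) * (y.den : ZMod ((p : ℕ) ^ n)) *
          (y.den : ZMod ((p : ℕ) ^ n))⁻¹ * e1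
      - ((x.num : ZMod ((p : ℕ) ^ n)) * y.num) * e2
  map_add' x y := by
    change _ = toA n (_ + _)
    refine toA_eq_of_dvd (x.den * y.den * (x + y).den) (by positivity) fun p hp => ?_
    have h12 : ¬ (p : ℕ) ∣ x.den * y.den := fun h => hp (h.mul_right _)
    have h3 := isUnit_of_not_dvd (n := n) p.2 fun h : (p : ℕ) ∣ (x + y).den => hp (h.mul_left _)
    have h1 := isUnit_of_not_dvd (n := n) p.2 fun h : (p : ℕ) ∣ x.den => h12 (h.mul_right _)
    have h2 := isUnit_of_not_dvd (n := n) p.2 fun h : (p : ℕ) ∣ y.den => h12 (h.mul_left _)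
    have hb : IsUnit (((x.den * y.den : ℕ) : ℤ) : ZMod ((p : ℕ) ^ n)) := by
      push_cast; exact h1.mul h2
    rw [ratMod_eq (a := x.num * y.den + y.num * x.den) (b := ((x.den * y.den : ℕ) : ℤ)) h3 hb
      (by push_cast; rw [← mul_assoc]; exact Rat.add_num_den' x y)]
    have e1 := ZMod.mul_inv_of_unit _ h1
    have e2 := ZMod.mul_inv_of_unit _ h2
    have e3 := ZMod.mul_inv_of_unit _ hb
    push_cast at e3 ⊢
    simp only [Pi.add_apply, ratMod]
    refine (hb.mul_left_inj).1 ?_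
    push_cast
    linear_combination ((x.num : ZMod ((p : ℕ) ^ n)) * y.den + y.num * x.den) * e3
      - ((x.num : ZMod ((p : ℕ) ^ n)) * y.den) * e1
      - ((y.num : ZMod ((p : ℕ) ^ n)) * x.den) * e2

/-- `𝒜ₙ` is a `ℚ`-algebra. -/
instance instAlgebraRatARing (n : ℕ) : Algebra ℚ (ARing n) := (ratToA n).toAlgebra

open Classical in
/-- `ζ_{𝒜ₙ}(k) = (∑_{0 < n₁ < ⋯ < nᵣ < p} 1 / (n₁^{k₁} ⋯ nᵣ^{kᵣ}) mod pⁿ)ₚ`.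
The inverses are taken in `ℤ/pⁿℤ`, where each `nᵢ` is a unit. -/
def zetaA (n : ℕ) (k : Index) : ARing n :=
  toA n fun p =>
    ∑ m ∈ (Fintype.piFinset fun _ : Fin k.length => Finset.Ioo 0 (p : ℕ)).filter
        (fun m => StrictMono m),
      ∏ i, (((m i : ZMod ((p : ℕ) ^ n)) ^ (k.get i : ℕ))⁻¹)

open Classical in
/-- `ζ^⋆_{𝒜ₙ}(k) = (∑_{1 ≤ n₁ ≤ ⋯ ≤ nᵣ ≤ p - 1} 1 / (n₁^{k₁} ⋯ nᵣ^{kᵣ}) mod pⁿ)ₚ`. -/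
def zetaAStar (n : ℕ) (k : Index) : ARing n :=
  toA n fun p =>
    ∑ m ∈ (Fintype.piFinset fun _ : Fin k.length => Finset.Icc 1 ((p : ℕ) - 1)).filter
        (fun m => Monotone m),
      ∏ i, (((m i : ZMod ((p : ℕ) ^ n)) ^ (k.get i : ℕ))⁻¹)

/-- `𝔷_{𝒜ₙ}(k) = (B_{p^{n-1}(p-1)-k+1} / (k - 1 + p^{n-1}) mod pⁿ)ₚ` for `n ≥ 1`, `k ≥ 2`.
The finitely many primes for which the subscript would be negative do not matter. -/
def frakZA (n : ℕ) (k : ℕ+) : ARing n :=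
  toA n fun p => ratMod ((p : ℕ) ^ n)
    (bernoulli ((p : ℕ) ^ (n - 1) * ((p : ℕ) - 1) + 1 - (k : ℕ)) /
      ((k : ℚ) - 1 + (p : ℚ) ^ (n - 1)))

/-! ### Multiple zeta values -/

/-- The multiple zeta value `ζ(k) = ∑_{0 < n₁ < ⋯ < nᵣ} 1 / (n₁^{k₁} ⋯ nᵣ^{kᵣ})`
(a convergent series when `k` is admissible; `ζ(∅) = 1`). -/
def mzv (k : Index) : ℝ :=
  ∑' m : {m : Fin k.length → ℕ+ // StrictMono m},
    ∏ i, (((m.1 i : ℕ) : ℝ) ^ (k.get i : ℕ))⁻¹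

/-- The `ℚ`-subalgebra `𝒵` of `ℝ` generated by all multiple zeta values. -/
def MZVAlg : Subalgebra ℚ ℝ := Algebra.adjoin ℚ {x | ∃ k : Index, Admissible k ∧ x = mzv k}

/-- The multiple zeta value of an admissible index as an element of `𝒵`. -/
def mzvZ (k : Index) (hk : Admissible k) : MZVAlg :=
  ⟨mzv k, Algebra.subset_adjoin ⟨k, hk, rfl⟩⟩

/-! ### The harmonic algebra and the harmonic regularization -/

/-- The `ℚ`-vector space `ℌ¹`, with basis the words `e_{k₁} ⋯ e_{kᵣ}` for all indices `k`. -/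
abbrev H1 := Index →₀ ℚ

/-- The basis element `e_k = e_{k₁} ⋯ e_{kᵣ}` of `ℌ¹`. -/
def word (k : Index) : H1 := Finsupp.single k 1

/-- The subspace `ℌ⁰` of `ℌ¹` spanned by the `e_k` with `k` admissible. -/
def H0 : Submodule ℚ H1 := Finsupp.supported ℚ ℚ {k | Admissible k}

/-- Left concatenation `w ↦ e_a w`. -/
def consL (a : ℕ+) : H1 →ₗ[ℚ] H1 := Finsupp.lmapDomain ℚ ℚ (fun w : Index => a :: w)

/-- The harmonic product of two words. -/
def harmWord : Index → Index → H1
  | [], w => word w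
  | a :: u, [] => word (a :: u)
  | a :: u, b :: v =>
      consL a (harmWord u (b :: v)) + consL b (harmWord (a :: u) v) + consL (a + b) (harmWord u v)
termination_by u v => u.length + v.length

/-- The harmonic product `*` on `ℌ¹`, extended `ℚ`-bilinearly. -/
def harm : H1 →ₗ[ℚ] H1 →ₗ[ℚ] H1 :=
  Finsupp.linearCombination ℚ fun u => Finsupp.linearCombination ℚ (harmWord u)

/-- `a ↦ a * e₁`. -/
def mulE1 : H1 →ₗ[ℚ] H1 := harm.flip (word [1])

/-- `a = ∑_{i=0}^{N} aᵢ * e₁ * ⋯ * e₁` (with `i` factors `e₁`), where all `aᵢ` lie in `ℌ⁰`.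
The `i`-th term, bracketed from the left, is `aᵢ * e₁^{*i}` because `*` is associative. -/
def IsExpansion (a : H1) (N : ℕ) (c : ℕ → H1) : Prop :=
  (∀ i, c i ∈ H0) ∧ a = ∑ i ∈ Finset.range (N + 1), (mulE1 ^ i) (c i)

/-- All entries are `1` (auxiliary). -/
def AllOnes (u : Index) : Prop := ∀ b ∈ u, b = 1

open Classical in
/-- The number of trailing ones (auxiliary). -/
def trail : Index → ℕ
  | [] => 0
  | a :: u => if AllOnes u then (if a = 1 then u.length + 1 else u.length) else trail u

theorem allOnes_nil : AllOnes [] := by intro b hb; simp at hb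

theorem allOnes_cons {a : ℕ+} {u : Index} : AllOnes (a :: u) ↔ a = 1 ∧ AllOnes u := by
  simp [AllOnes]

theorem allOnes_append_one {u : Index} : AllOnes (u ++ [1]) ↔ AllOnes u := by
  simp [AllOnes, or_imp]

theorem trail_of_allOnes {u : Index} (h : AllOnes u) : trail u = u.length := by
  cases u with
  | nil => rfl
  | cons a u => rw [allOnes_cons] at h; simp [trail, h.1, h.2]

theorem trail_cons_le (a : ℕ+) (u : Index) : trail (a :: u) ≤ trail u + 1 := by
  unfold trail
  split_ifs with h h'
  · rw [← trail_of_allOnes h]; cases u <;> simp [trail]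
  · rw [← trail_of_allOnes h]; cases u <;> simp [trail]
  · cases u <;> simp [trail]

theorem trail_cons_of_ne {a : ℕ+} (ha : a ≠ 1) (u : Index) : trail (a :: u) = trail u := by
  by_cases h : AllOnes u
  · rw [trail_of_allOnes h]; simp [trail, h, ha]
  · rw [trail]; simp [h]

theorem trail_cons_of_not {u : Index} (a : ℕ+) (h : ¬ AllOnes u) : trail (a :: u) = trail u := by
  rw [trail]; simp [h]

theorem trail_append_one (u : Index) : trail (u ++ [1]) = trail u + 1 := by
  induction u with
  | nil => simp [trail, allOnes_nil]
  | cons a u ih =>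
    rw [List.cons_append]
    by_cases h : AllOnes u
    · have h' := allOnes_append_one.2 h
      by_cases ha : a = 1 <;> simp [trail, h, h', ha]
    · have h' := fun x => h (allOnes_append_one.1 x)
      rw [trail_cons_of_not a h', trail_cons_of_not a h, ih]

theorem trail_eq_zero_or (v : Index) :
    (trail v = 0 ∧ Admissible v) ∨ ∃ u, v = u ++ [1] ∧ ¬ Admissible v := by
  induction v using List.reverseRecOn with
  | nil => left; simp [trail, Admissible]
  | append_singleton u a _ =>
    by_cases ha : a = 1
    · right; subst ha; exact ⟨u, rfl, by simp [Admissible]⟩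
    · left
      constructor
      · clear * - ha
        induction u with
        | nil => simp [trail, allOnes_nil, ha]
        | cons b u ih =>
          have : ¬ AllOnes (u ++ [a]) := fun h => ha (h a (by simp))
          rw [List.cons_append, trail_cons_of_not b this, ih]
      · intro b hb
        simp only [List.getLast?_append, List.getLast?_singleton, Option.some_or,
          Option.mem_def, Option.some.injEq] at hb
        subst hb
        exact PNat.add_one_le_iff.2 ((show (1 : ℕ+) ≤ a from one_le).lt_of_ne (Ne.symm ha))

theorem admissible_iff_trail (v : Index) : Admissible v ↔ trail v = 0 := by
  rcases trail_eq_zero_or v with ⟨h0, h⟩ | ⟨u, rfl, h⟩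
  · simp [h0, h]
  · simp [h, trail_append_one]

theorem harmWord_nil_right (u : Index) : harmWord u [] = word u := by
  cases u <;> simp [harmWord]

theorem consL_word (a : ℕ+) (u : Index) : consL a (word u) = word (a :: u) := by
  simp [consL, word, Finsupp.lmapDomain_apply]

theorem consL_mem {a : ℕ+} {x : H1} {S T : Set Index} (hx : x ∈ Finsupp.supported ℚ ℚ S)
    (h : ∀ u ∈ S, a :: u ∈ T) : consL a x ∈ Finsupp.supported ℚ ℚ T := by
  have := Finsupp.lmapDomain_supported ℚ ℚ (fun w : Index => a :: w) S
  have h2 : consL a x ∈ Finsupp.supported ℚ ℚ ((fun w : Index => a :: w) '' S) := by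
    rw [← this]; exact ⟨x, hx, rfl⟩
  refine Finsupp.supported_mono ?_ h2
  rintro _ ⟨u, hu, rfl⟩
  exact h u hu

theorem word_mem {u : Index} {S : Set Index} (h : u ∈ S) : word u ∈ Finsupp.supported ℚ ℚ S :=
  Finsupp.single_mem_supported ℚ 1 h

theorem harmWord_one (u : Index) :
    harmWord u [1] - ((trail u + 1 : ℕ) : ℚ) • word (u ++ [1]) ∈
      Finsupp.supported ℚ ℚ {v | trail v ≤ trail u ∧ (AllOnes v → AllOnes u)} := by
  induction u with
  | nil => simp [harmWord, trail]
  | cons a u ih =>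
    set r := harmWord u [1] - ((trail u + 1 : ℕ) : ℚ) • word (u ++ [1]) with hr
    have e : harmWord (a :: u) [1] = ((trail u + 1 : ℕ) : ℚ) • word (a :: u ++ [1]) + consL a r
        + word (1 :: a :: u) + word ((a + 1) :: u) := by
      rw [harmWord, harmWord_nil_right, harmWord_nil_right, consL_word, consL_word, hr, map_sub,
        map_smul, consL_word, List.cons_append]
      abel
    have ha1 : a + 1 ≠ 1 := fun h => by
      have := congrArg PNat.val h
      have h2 := a.pos
      simp only [PNat.add_coe, PNat.one_coe] at this
      omega
    by_cases hu : AllOnes u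
    · by_cases ha : a = 1
      · subst ha
        have hau : AllOnes (1 :: u) := allOnes_cons.2 ⟨rfl, hu⟩
        have ht : trail ((1 : ℕ+) :: u) = trail u + 1 := by
          rw [trail_of_allOnes hau, trail_of_allOnes hu]; rfl
        have hw : word (1 :: 1 :: u) = word (1 :: u ++ [1]) := by
          congr 1
          have : u = List.replicate u.length 1 := List.eq_replicate_iff.2 ⟨rfl, hu⟩
          rw [this, List.cons_append, ← List.replicate_succ, ← List.replicate_succ']
        have e2 : harmWord (1 :: u) [1] - ((trail (1 :: u) + 1 : ℕ) : ℚ) • word (1 :: u ++ [1])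
            = consL 1 r + word ((1 + 1) :: u) := by
          rw [e, hw, ht]; push_cast; module
        rw [e2]
        refine add_mem (consL_mem ih ?_) (word_mem ⟨?_, fun _ => hau⟩)
        · rintro v ⟨hv, -⟩
          refine ⟨?_, fun _ => hau⟩
          have := trail_cons_le 1 v
          omega
        · rw [trail_cons_of_ne ha1]; omega
      · have ht : trail (a :: u) = trail u := trail_cons_of_ne ha u
        have hna : ∀ v, ¬ AllOnes (a :: v) := fun v h => ha (allOnes_cons.1 h).1
        have e2 : harmWord (a :: u) [1] - ((trail (a :: u) + 1 : ℕ) : ℚ) • word (a :: u ++ [1])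
            = consL a r + word (1 :: a :: u) + word ((a + 1) :: u) := by
          rw [e, ht]; module
        rw [e2]
        refine add_mem (add_mem (consL_mem ih ?_) (word_mem ⟨?_, ?_⟩)) (word_mem ⟨?_, ?_⟩)
        · rintro v ⟨hv, -⟩
          exact ⟨by rw [trail_cons_of_ne ha, ht]; exact hv, fun h => absurd h (hna v)⟩
        · rw [trail_cons_of_not 1 (hna u)]
        · exact fun h => absurd (allOnes_cons.1 h).2 (hna u)
        · rw [trail_cons_of_ne ha1, ht]
        · exact fun h => absurd (allOnes_cons.1 h).1 ha1
    · have ht : trail (a :: u) = trail u := trail_cons_of_not a hu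
      have hna : ¬ AllOnes (a :: u) := fun h => hu (allOnes_cons.1 h).2
      have e2 : harmWord (a :: u) [1] - ((trail (a :: u) + 1 : ℕ) : ℚ) • word (a :: u ++ [1])
          = consL a r + word (1 :: a :: u) + word ((a + 1) :: u) := by
        rw [e, ht]; module
      rw [e2]
      refine add_mem (add_mem (consL_mem ih ?_) (word_mem ⟨?_, ?_⟩)) (word_mem ⟨?_, ?_⟩)
      · rintro v ⟨hv, hv'⟩
        have hnv : ¬ AllOnes v := fun h => hu (hv' h)
        exact ⟨by rw [trail_cons_of_not a hnv, ht]; exact hv,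
          fun h => absurd (allOnes_cons.1 h).2 hnv⟩
      · rw [trail_cons_of_not 1 hna]
      · exact fun h => absurd (allOnes_cons.1 h).2 hna
      · rw [trail_cons_of_not _ hu, ht]
      · exact fun h => absurd (allOnes_cons.1 h).2 hu

theorem mulE1_word (u : Index) : mulE1 (word u) = harmWord u [1] := by
  simp [mulE1, harm, word]

/-- Words with at most `t` trailing ones (auxiliary). -/
def trailLe (t : ℕ) : Submodule ℚ H1 := Finsupp.supported ℚ ℚ {v | trail v ≤ t}

theorem induction_trailLe {t : ℕ} {P : H1 → Prop} (x : H1) (hx : x ∈ trailLe t) (h0 : P 0)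
    (hadd : ∀ x y, P x → P y → P (x + y))
    (hword : ∀ (q : ℚ) (u : Index), trail u ≤ t → P (q • word u)) : P x := by
  rw [trailLe, Finsupp.mem_supported] at hx
  rw [← Finsupp.sum_single x]
  refine Finset.sum_induction _ P hadd h0 fun u hu => ?_
  have := hword (x u) u (hx hu)
  simpa [word] using this

theorem mulE1_trailLe {t : ℕ} {x : H1} (hx : x ∈ trailLe t) :
    mulE1 x ∈ trailLe (t + 1) ∧ ∀ u : Index, trail u = t → mulE1 x (u ++ [1]) = (t + 1) * x u := by
  refine induction_trailLe (P := fun x => mulE1 x ∈ trailLe (t + 1) ∧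
    ∀ u : Index, trail u = t → mulE1 x (u ++ [1]) = (t + 1) * x u) x hx ?_ ?_ ?_
  · simp
  · rintro x y ⟨hx, hx'⟩ ⟨hy, hy'⟩
    refine ⟨by rw [map_add]; exact add_mem hx hy, fun u hu => ?_⟩
    rw [map_add, Finsupp.add_apply, hx' u hu, hy' u hu, Finsupp.add_apply]; ring
  · intro q w hw
    have h := harmWord_one w
    set r := harmWord w [1] - ((trail w + 1 : ℕ) : ℚ) • word (w ++ [1]) with hr
    have e : harmWord w [1] = ((trail w + 1 : ℕ) : ℚ) • word (w ++ [1]) + r := by rw [hr]; abel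
    rw [map_smul, mulE1_word, e]
    constructor
    · refine Submodule.smul_mem _ _ (add_mem (Submodule.smul_mem _ _ (word_mem ?_)) ?_)
      · change trail _ ≤ _
        rw [trail_append_one]; omega
      · refine Finsupp.supported_mono ?_ h
        rintro v ⟨hv, -⟩
        exact hv.trans (by omega)
    · intro u hu
      have hr0 : r (u ++ [1]) = 0 := by
        by_contra hne
        have := (Finsupp.mem_supported ℚ r).1 h (Finsupp.mem_support_iff.2 hne)
        have h1 := this.1
        rw [trail_append_one] at h1
        omega
      rw [Finsupp.smul_apply, Finsupp.add_apply, hr0, add_zero, Finsupp.smul_apply,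
        Finsupp.smul_apply]
      by_cases hwu : w = u
      · subst hwu; simp [word, hu]; ring
      · have : w ++ [1] ≠ u ++ [1] := fun h => hwu (List.append_cancel_right h)
        simp [word, Finsupp.single_eq_of_ne' this, Finsupp.single_eq_of_ne' hwu]

theorem mem_H0_iff (x : H1) : x ∈ H0 ↔ x ∈ trailLe 0 := by
  have : {k | Admissible k} = {v | trail v ≤ 0} := by
    ext v; simp [admissible_iff_trail]
  rw [H0, trailLe, this]

theorem mulE1_pow {x : H1} (hx : x ∈ H0) (i : ℕ) :
    (mulE1 ^ i) x ∈ trailLe i ∧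
      ∀ u : Index, trail u = 0 → (mulE1 ^ i) x (u ++ List.replicate i 1) = i.factorial * x u := by
  induction i with
  | zero => simpa using (mem_H0_iff x).1 hx
  | succ i ih =>
    obtain ⟨h1, h2⟩ := mulE1_trailLe ih.1
    have e : (mulE1 ^ (i + 1)) x = mulE1 ((mulE1 ^ i) x) := by
      rw [pow_succ', Module.End.mul_apply]
    refine ⟨by rw [e]; exact h1, fun u hu => ?_⟩
    have ht : trail (u ++ List.replicate i 1) = i := by
      clear * - hu
      induction i with
      | zero => simpa using hu
      | succ i ih => rw [List.replicate_succ', ← List.append_assoc, trail_append_one, ih]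
    rw [e, List.replicate_succ', ← List.append_assoc, h2 _ ht, ih.2 u hu, Nat.factorial_succ]
    push_cast; ring

/-- The powers of `e₁` are independent over `ℌ⁰`. -/
theorem expansion_zero (N : ℕ) (c : ℕ → H1) (hc : ∀ i, c i ∈ H0)
    (h : ∑ i ∈ Finset.range N, (mulE1 ^ i) (c i) = 0) : ∀ i < N, c i = 0 := by
  induction N with
  | zero => intro i hi; omega
  | succ N ih =>
    have hN : c N = 0 := by
      ext u
      by_cases hu : trail u = 0
      · have h1 := congrArg (fun x : H1 => x (u ++ List.replicate N 1)) h
        have h2 : (∑ i ∈ Finset.range N, (mulE1 ^ i) (c i)) (u ++ List.replicate N 1) = 0 := by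
          rw [Finsupp.finsetSum_apply]
          refine Finset.sum_eq_zero fun i hi => ?_
          by_contra hne
          have := (Finsupp.mem_supported ℚ _).1 (mulE1_pow (hc i) i).1
            (Finsupp.mem_support_iff.2 hne)
          have ht : trail (u ++ List.replicate N 1) = N := by
            clear * - hu
            induction N with
            | zero => simpa using hu
            | succ i ih => rw [List.replicate_succ', ← List.append_assoc, trail_append_one, ih]
          have h3 : trail (u ++ List.replicate N 1) ≤ i := this
          have := Finset.mem_range.1 hi
          omega
        rw [Finset.sum_range_succ] at h1
        simp only [Finsupp.add_apply, h2, zero_add, (mulE1_pow (hc N) N).2 u hu,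
          Finsupp.zero_apply] at h1
        have hf : (N.factorial : ℚ) ≠ 0 := by exact_mod_cast N.factorial_ne_zero
        simpa [hf] using h1
      · by_contra hne
        have := (Finsupp.mem_supported ℚ _).1 (hc N) (Finsupp.mem_support_iff.2 hne)
        exact hu ((admissible_iff_trail u).1 this)
    intro i hi
    rcases Nat.lt_succ_iff_lt_or_eq.1 hi with h' | rfl
    · refine ih ?_ i h'
      rw [Finset.sum_range_succ, hN, map_zero, add_zero] at h
      exact h
    · exact hN

theorem isExpansion_pad {a : H1} {N : ℕ} {c : ℕ → H1} (h : IsExpansion a N c) {M : ℕ}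
    (hM : N ≤ M) : IsExpansion a M (fun i => if i ≤ N then c i else 0) := by
  refine ⟨fun i => ?_, ?_⟩
  · dsimp only
    split_ifs
    · exact h.1 i
    · exact zero_mem _
  · rw [h.2, ← Finset.sum_subset (Finset.range_mono (Nat.succ_le_succ hM))]
    · refine Finset.sum_congr rfl fun i hi => ?_
      dsimp only
      rw [if_pos (Nat.lt_succ_iff.1 (Finset.mem_range.1 hi))]
    · intro i _ hi
      dsimp only
      rw [if_neg (fun h => hi (Finset.mem_range.2 (Nat.lt_succ_of_le h))), map_zero]

/-- The constant term of an expansion is unique. -/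
theorem expansion_unique {a : H1} {N M : ℕ} {c d : ℕ → H1} (hc : IsExpansion a N c)
    (hd : IsExpansion a M d) : c 0 = d 0 := by
  have h1 := isExpansion_pad hc (le_max_left N M)
  have h2 := isExpansion_pad hd (le_max_right N M)
  have := expansion_zero (max N M + 1)
    (fun i => (if i ≤ N then c i else 0) - (if i ≤ M then d i else 0))
    (fun i => sub_mem (h1.1 i) (h2.1 i))
    (by simp only [map_sub, Finset.sum_sub_distrib]; rw [← h1.2, ← h2.2, sub_self]) 0 (by omega)
  simpa [sub_eq_zero] using this

theorem exists_expansion_add {a b : H1} (ha : ∃ N c, IsExpansion a N c)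
    (hb : ∃ N c, IsExpansion b N c) : ∃ N c, IsExpansion (a + b) N c := by
  obtain ⟨N, c, hc⟩ := ha
  obtain ⟨M, d, hd⟩ := hb
  have h1 := isExpansion_pad hc (le_max_left N M)
  have h2 := isExpansion_pad hd (le_max_right N M)
  refine ⟨max N M, _, fun i => add_mem (h1.1 i) (h2.1 i), ?_⟩
  simp only [map_add, Finset.sum_add_distrib]
  rw [← h1.2, ← h2.2]

theorem exists_expansion_smul {a : H1} (q : ℚ) (ha : ∃ N c, IsExpansion a N c) :
    ∃ N c, IsExpansion (q • a) N c := by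
  obtain ⟨N, c, hc⟩ := ha
  refine ⟨N, fun i => q • c i, fun i => Submodule.smul_mem _ _ (hc.1 i), ?_⟩
  simp only [map_smul, ← Finset.smul_sum]
  rw [← hc.2]

theorem exists_expansion_mulE1 {a : H1} (ha : ∃ N c, IsExpansion a N c) :
    ∃ N c, IsExpansion (mulE1 a) N c := by
  obtain ⟨N, c, hc⟩ := ha
  refine ⟨N + 1, fun i => if i = 0 then 0 else c (i - 1), fun i => ?_, ?_⟩
  · dsimp only
    split_ifs
    · exact zero_mem _
    · exact hc.1 _
  · rw [Finset.sum_range_succ', hc.2, map_sum]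
    simp [pow_succ', Module.End.mul_apply]

theorem exists_expansion_of_trailLe (t : ℕ) : ∀ a ∈ trailLe t, ∃ N c, IsExpansion a N c := by
  induction t with
  | zero =>
    intro a ha
    refine ⟨0, fun i => if i = 0 then a else 0, fun i => ?_, by simp⟩
    dsimp only
    split_ifs
    · exact (mem_H0_iff a).2 ha
    · exact zero_mem _
  | succ t ih =>
    intro a ha
    refine induction_trailLe (P := fun a => ∃ N c, IsExpansion a N c) a ha (ih 0 (zero_mem _)) 
      (fun x y hx hy => exists_expansion_add hx hy) fun q v hv => exists_expansion_smul q ?_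
    by_cases hvt : trail v ≤ t
    · exact ih _ (word_mem hvt)
    rcases trail_eq_zero_or v with ⟨h0, -⟩ | ⟨u, rfl, -⟩
    · omega
    rw [trail_append_one] at hv hvt
    have hu : trail u = t := by omega
    have h := harmWord_one u
    set r := harmWord u [1] - ((trail u + 1 : ℕ) : ℚ) • word (u ++ [1]) with hr
    have hr' : r ∈ trailLe t := by
      refine Finsupp.supported_mono ?_ h
      rintro v ⟨hv, -⟩
      exact hv.trans hu.le
    have e : word (u ++ [1]) =
        ((trail u + 1 : ℕ) : ℚ)⁻¹ • (mulE1 (word u) + (-1 : ℚ) • r) := by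
      have hne : ((trail u + 1 : ℕ) : ℚ) ≠ 0 := by positivity
      rw [mulE1_word, hr, neg_one_smul, neg_sub, add_sub_cancel, smul_smul, inv_mul_cancel₀ hne,
        one_smul]
    rw [e]
    exact exists_expansion_smul _ (exists_expansion_add
      (exists_expansion_mulE1 (ih _ (word_mem hu.le))) (exists_expansion_smul _ (ih r hr')))

/-- Every element of `ℌ¹` is a polynomial in `e₁` over `ℌ⁰`. -/
theorem exists_expansion (a : H1) : ∃ N c, IsExpansion a N c := by
  refine exists_expansion_of_trailLe (a.support.sup trail) a ?_
  exact (Finsupp.mem_supported ℚ a).2 fun v hv => Finset.le_sup (f := trail) hv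

/-- The harmonic regularization `reg_* : ℌ¹ → ℌ⁰`: the constant term `a₀` of the expansion
`a = ∑ aᵢ * e₁^{*i}` with all `aᵢ` in `ℌ⁰`. -/
def reg (a : H1) : H1 := (exists_expansion a).choose_spec.choose 0

theorem reg_spec (a : H1) : ∃ N c, IsExpansion a N c ∧ reg a = c 0 :=
  ⟨_, _, (exists_expansion a).choose_spec.choose_spec, rfl⟩

theorem reg_eq {a : H1} {N : ℕ} {c : ℕ → H1} (h : IsExpansion a N c) : reg a = c 0 :=
  expansion_unique (exists_expansion a).choose_spec.choose_spec h

theorem reg_mem (a : H1) : reg a ∈ H0 := by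
  obtain ⟨N, c, hc, h⟩ := reg_spec a
  rw [h]; exact hc.1 0

open Classical in
/-- The `ℚ`-linear map `Z : ℌ⁰ → 𝒵` with `Z(e_k) = ζ(k)` for admissible `k`,
extended by `0` on the other words. -/
def Zmap : H1 →ₗ[ℚ] MZVAlg :=
  Finsupp.linearCombination ℚ fun k => if hk : Admissible k then mzvZ k hk else 0

/-- The harmonic regularized multiple zeta value `ζ^*(k) = Z(reg_*(e_k))`. -/
def zetaHarm (k : Index) : MZVAlg := Zmap (reg (word k))

/-! ### `t`-adic symmetric and `𝒮ₙ`-multiple zeta(-star) values -/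

/-- `ζ(2)` as an element of `𝒵`. -/
def zeta2 : MZVAlg := mzvZ [2] (by simp [Admissible])

/-- `𝒵 / ζ(2)𝒵`. -/
abbrev ZBar : Type := MZVAlg ⧸ Ideal.span {zeta2}

/-- The index `(d₁ + l₁, …, dₛ + lₛ)`. -/
def addIndex (d : Index) (l : Fin d.length → ℕ) : Index :=
  List.ofFn fun j => (⟨(d.get j : ℕ) + l j, Nat.add_pos_left (d.get j).pos _⟩ : ℕ+)

/-- For `d = (k_{i+1}, …, k_r)`, the power series
`∑_l [∏_j binom(k_j + l_j - 1, l_j)] ζ^*(k_r + l_r, …, k_{i+1} + l_{i+1}) t^{l_{i+1} + ⋯ + l_r}`,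
`l = (l_{i+1}, …, l_r)` running over all tuples of non-negative integers. -/
def tailSeries (d : Index) : PowerSeries MZVAlg :=
  PowerSeries.mk fun m =>
    ∑ l ∈ Finset.Nat.antidiagonalTuple d.length m,
      ((∏ j, ((d.get j : ℕ) + l j - 1).choose (l j) : ℕ) : MZVAlg) *
        zetaHarm (addIndex d l).reverse

/-- The `t`-adic symmetric multiple zeta value, before reduction modulo `ζ(2)`:
`∑_{i=0}^r (-1)^{k_{i+1} + ⋯ + k_r} ζ^*(k₁, …, kᵢ) · tailSeries (k_{i+1}, …, k_r)`. -/
def zetaSHatLift (k : Index) : PowerSeries MZVAlg :=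
  ∑ i ∈ Finset.range (k.length + 1),
    PowerSeries.C ((-1) ^ (((k.drop i).map fun a : ℕ+ => (a : ℕ)).sum) * zetaHarm (k.take i)) *
      tailSeries (k.drop i)

/-- The `t`-adic symmetric multiple zeta value in `(𝒵/ζ(2)𝒵)[[t]]`. -/
def zetaSHat (k : Index) : PowerSeries ZBar :=
  PowerSeries.map (Ideal.Quotient.mk (Ideal.span {zeta2})) (zetaSHatLift k)

/-- The `t`-adic symmetric multiple zeta-star value: the sum of `zetaSHat` over all
`k₁ □ ⋯ □ kᵣ`, where every `□` is a comma or a plus. -/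
def zetaSHatStar (k : Index) : PowerSeries ZBar := ((contractions k).map zetaSHat).sum

/-- The ring `(𝒵/ζ(2)𝒵)[[t]]/(tⁿ)`. -/
abbrev SRing (n : ℕ) : Type :=
  PowerSeries ZBar ⧸ Ideal.span {(PowerSeries.X : PowerSeries ZBar) ^ n}

/-- The projection `πₙ`. -/
def toS (n : ℕ) : PowerSeries ZBar →+* SRing n := Ideal.Quotient.mk _

/-- The `𝒮ₙ`-multiple zeta value. -/
def zetaS (n : ℕ) (k : Index) : SRing n := toS n (zetaSHat k)

/-- The `𝒮ₙ`-multiple zeta-star value. -/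
def zetaSStar (n : ℕ) (k : Index) : SRing n := toS n (zetaSHatStar k)

/-- `𝔷_{𝒮ₙ}(k) = ζ(k) mod ζ(2)` for `k ≥ 2`. -/
def frakZS (n : ℕ) (k : ℕ+) : SRing n :=
  toS n (PowerSeries.C (Ideal.Quotient.mk (Ideal.span {zeta2}) (Zmap (word [k]))))

end FiniteMZV

end

open Filter Topology
open Finset.HasAntidiagonal (antidiagonal mem_antidiagonal)

/-! ### Truncated sums and the harmonic product. -/

namespace FiniteMZV

/-! Let S be a family of values, indexed by indices, that multiplies by the harmonic (stuffle)
product: multiple harmonic sums modulo p for 𝒜, harmonic regularized values modulo ζ(2) for 𝒮. The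
depth-three antipode relation `antipode_of_stuffle` expresses S(a,b,c) - S(c,b,a) through products
and values of depth at most two. In odd weight k = a+b+c this is enough.

Modulo p, depth-one sums vanish and n ↦ p - n gives S(c,b,a) = -S(a,b,c), so the relation computes 2
S(a,b,c). For 𝒮, working modulo t leaves only constant terms, and the symmetric sum is S(a,b,c) -
S(c,b,a) plus two signed mixed products. Even zeta values are zero modulo ζ(2), so these signs are
exactly those that cancel the mixed products of the antipode relation. Either way only S(c+b,a) +
S(c,b+a) remains, plus S(k) in the case 𝒮 (the depth-one value S(k) is zero modulo p).

Depth two modulo p (`modSum_pair`): Fermat's theorem and Faulhaber's formula turn S(a,b) into a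
combination of power sums over the nonzero residues; exactly one is nonzero, and its coefficient
carries B_{p-a-b}.

Depth two modulo ζ(2): the stuffle product gives S(a,b) + S(b,a), and the double shuffle relations
in odd weight give S(a,b) - S(b,a) (`sub_swap_of_double_shuffle`). The shuffle relations come from
partial fractions; the boundary case, in which one factor would be ζ(1), comes from Euler's sum
formula.

That regularized values obey the stuffle product (`zetaHarm_mul`) is proved analytically. Truncated
sums obey it exactly, and each is a polynomial in the harmonic number H_N up to an error negligible
against every power of H_N. The regularized value is the constant term of that polynomial.

The star value is the sum over contractions. Its depth-one term vanishes and its depth-two terms add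
up to -2 S(a,b,c), respectively -2 times the symmetric sum, which gives the sign in the theorem. -/

/-- The truncated sum `∑_{M < n₁ < ⋯ < nᵣ ≤ N} g k₁ n₁ ⋯ g kᵣ nᵣ`. -/
def truncSum {R : Type*} [CommSemiring R] (g : ℕ+ → ℕ → R) (N : ℕ) : Index → ℕ → R
  | [], _ => 1
  | a :: u, M => ∑ n ∈ Finset.Ioc M N, g a n * truncSum g N u n

/-- The words, with multiplicity, of the harmonic product of two words. -/
def stuffle : Index → Index → List Index
  | [], w => [w]
  | a :: u, [] => [a :: u]
  | a :: u, b :: v =>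
      (stuffle u (b :: v)).map (a :: ·) ++ (stuffle (a :: u) v).map (b :: ·) ++
        (stuffle u v).map ((a + b) :: ·)
termination_by u v => u.length + v.length

theorem map_consL_sum (a : ℕ+) (l : List Index) :
    ((l.map (a :: ·)).map word).sum = consL a (l.map word).sum := by
  induction l with
  | nil => simp
  | cons u l ih => simp only [List.map_cons, List.sum_cons, ih, map_add, consL_word]

/-- Replacing elements of ℌ¹ by lists of words lets the harmonic product be evaluated on values in
any ring, in particular in characteristic p. -/
theorem harmWord_eq_stuffle (u v : Index) : harmWord u v = ((stuffle u v).map word).sum := by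
  induction u, v using stuffle.induct with
  | case1 w => simp [harmWord, stuffle]
  | case2 a u => simp [harmWord, stuffle]
  | case3 a u b v h1 h2 h3 =>
    rw [harmWord, stuffle, List.map_append, List.map_append, List.sum_append, List.sum_append,
      map_consL_sum, map_consL_sum, map_consL_sum, h1, h2, h3]

/-- The square of pairs (n, m) splits into n < m, m < n and n = m; these are the three terms of the
recursion for the harmonic product. -/
theorem sum_Ioc_mul_sum_Ioc {R : Type*} [CommSemiring R] (x y : ℕ → R) (M N : ℕ) :
    (∑ n ∈ Finset.Ioc M N, x n) * (∑ n ∈ Finset.Ioc M N, y n) =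
      ∑ n ∈ Finset.Ioc M N, x n * ∑ m ∈ Finset.Ioc n N, y m +
      ∑ n ∈ Finset.Ioc M N, y n * ∑ m ∈ Finset.Ioc n N, x m +
      ∑ n ∈ Finset.Ioc M N, x n * y n := by
  have key : ∀ (z : ℕ → R), ∀ n ∈ Finset.Ioc M N,
      ∑ m ∈ Finset.Ioc n N, z m = ∑ m ∈ Finset.Ioc M N, if n < m then z m else 0 := by
    intro z n hn
    rw [← Finset.sum_filter]
    refine Finset.sum_congr ?_ fun _ _ => rfl
    ext m
    simp only [Finset.mem_Ioc, Finset.mem_filter] at hn ⊢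
    omega
  have e1 : ∑ n ∈ Finset.Ioc M N, x n * ∑ m ∈ Finset.Ioc n N, y m =
      ∑ n ∈ Finset.Ioc M N, ∑ m ∈ Finset.Ioc M N, if n < m then x n * y m else 0 := by
    refine Finset.sum_congr rfl fun n hn => ?_
    rw [key y n hn, Finset.mul_sum]
    simp only [mul_ite, mul_zero]
  have e2 : ∑ n ∈ Finset.Ioc M N, y n * ∑ m ∈ Finset.Ioc n N, x m =
      ∑ n ∈ Finset.Ioc M N, ∑ m ∈ Finset.Ioc M N, if m < n then x n * y m else 0 := by
    rw [Finset.sum_comm]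
    refine Finset.sum_congr rfl fun n hn => ?_
    rw [key x n hn, Finset.mul_sum]
    exact Finset.sum_congr rfl fun m _ => by rw [mul_ite, mul_zero, mul_comm (y n)]
  have e3 : ∑ n ∈ Finset.Ioc M N, x n * y n =
      ∑ n ∈ Finset.Ioc M N, ∑ m ∈ Finset.Ioc M N, if n = m then x n * y m else 0 := by
    refine Finset.sum_congr rfl fun n hn => ?_
    rw [Finset.sum_ite_eq, if_pos hn]
  rw [e1, e2, e3, Finset.sum_mul_sum, ← Finset.sum_add_distrib, ← Finset.sum_add_distrib]
  refine Finset.sum_congr rfl fun n _ => ?_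
  rw [← Finset.sum_add_distrib, ← Finset.sum_add_distrib]
  refine Finset.sum_congr rfl fun m _ => ?_
  rcases lt_trichotomy n m with h | h | h
  · simp [h, h.not_gt, h.ne]
  · simp [h]
  · simp [h, h.not_gt, h.ne']

section
variable {R : Type*} [CommSemiring R] (g : ℕ+ → ℕ → R) (N : ℕ)

theorem truncSum_map_cons (a : ℕ+) (l : List Index) (M : ℕ) :
    ((l.map (a :: ·)).map (truncSum g N · M)).sum =
      ∑ n ∈ Finset.Ioc M N, g a n * (l.map (truncSum g N · n)).sum := by
  induction l with
  | nil => simp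
  | cons u l ih =>
    simp only [List.map_cons, List.sum_cons, ih, mul_add, Finset.sum_add_distrib]
    rfl

/-- Truncated sums multiply according to the harmonic product. -/
theorem truncSum_mul (hg : ∀ a b n, g (a + b) n = g a n * g b n) (u v : Index) (M : ℕ) :
    truncSum g N u M * truncSum g N v M = ((stuffle u v).map (truncSum g N · M)).sum := by
  induction u, v using stuffle.induct generalizing M with
  | case1 w => simp [truncSum, stuffle]
  | case2 a u => simp [truncSum, stuffle]
  | case3 a u b v h1 h2 h3 =>
    rw [stuffle, List.map_append, List.map_append, List.sum_append, List.sum_append,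
      truncSum_map_cons, truncSum_map_cons, truncSum_map_cons, truncSum, truncSum,
      sum_Ioc_mul_sum_Ioc]
    congr 1
    · congr 1
      · refine Finset.sum_congr rfl fun n _ => ?_
        rw [← h1, mul_assoc]; rfl
      · refine Finset.sum_congr rfl fun n _ => ?_
        rw [← h2, mul_assoc, mul_comm (truncSum g N (a :: u) n)]; rfl
    · refine Finset.sum_congr rfl fun n _ => ?_
      rw [← h3, hg]; ring

/-- Truncated sums as sums over strictly increasing tuples. -/
theorem sum_strictMono_eq_truncSum (k : Index) (M : ℕ)
    (inst : DecidablePred fun m : Fin k.length → ℕ => StrictMono m) :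
    ∑ m ∈ (Fintype.piFinset fun _ : Fin k.length => Finset.Ioc M N).filter
      (fun m => StrictMono m), ∏ i, g (k.get i) (m i) = truncSum g N k M := by
  classical
  induction k generalizing M with
  | nil =>
    rw [truncSum]
    have : (Fintype.piFinset fun _ : Fin ([] : Index).length => Finset.Ioc M N).filter
      (fun m => StrictMono m) = {fun i => i.elim0} := by
      ext m
      simp only [Finset.mem_filter, Fintype.mem_piFinset, Finset.mem_singleton]
      exact ⟨fun _ => funext fun i => i.elim0, fun _ => ⟨fun i => i.elim0, fun i => i.elim0⟩⟩
    rw [this, Finset.sum_singleton]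
    exact Finset.prod_empty
  | cons a u ih =>
    rw [truncSum]
    have e : ∀ n ∈ Finset.Ioc M N, g a n * truncSum g N u n =
        ∑ m ∈ (Fintype.piFinset fun _ : Fin u.length => Finset.Ioc n N).filter
          (fun m => StrictMono m), g a n * ∏ i, g (u.get i) (m i) := fun n _ => by
      rw [← ih n inferInstance, Finset.mul_sum]
    rw [Finset.sum_congr rfl e, Finset.sum_sigma']
    refine Finset.sum_bij' (fun m _ => ⟨m (0 : Fin (u.length + 1)), Fin.tail m⟩)
      (fun s _ => (Fin.cons s.1 s.2 : Fin (u.length + 1) → ℕ)) ?_ ?_ ?_ ?_ ?_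
    · intro m hm
      simp only [Finset.mem_filter, Fintype.mem_piFinset, Finset.mem_sigma, Finset.mem_Ioc] at hm ⊢
      obtain ⟨h1, h2⟩ := hm
      refine ⟨h1 (0 : Fin (u.length + 1)), fun i => ⟨h2 (Fin.succ_pos i), (h1 (Fin.succ i)).2⟩,
        fun i j hij => h2 (Fin.succ_lt_succ_iff.2 hij)⟩
    · rintro ⟨n, m⟩ hm
      simp only [Finset.mem_filter, Fintype.mem_piFinset, Finset.mem_sigma, Finset.mem_Ioc] at hm ⊢
      obtain ⟨h0, h1, h2⟩ := hm
      constructor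
      · intro i
        refine Fin.cases (motive := fun i : Fin (u.length + 1) =>
          M < (Fin.cons n m : Fin (u.length + 1) → ℕ) i ∧
          (Fin.cons n m : Fin (u.length + 1) → ℕ) i ≤ N) ?_ (fun j => ?_) i
        · simpa using h0
        · rw [Fin.cons_succ]; exact ⟨h0.1.trans (h1 j).1, (h1 j).2⟩
      · intro i j hij
        refine Fin.cases (motive := fun i : Fin (u.length + 1) => ∀ j, i < j →
          (Fin.cons n m : Fin (u.length + 1) → ℕ) i <
          (Fin.cons n m : Fin (u.length + 1) → ℕ) j) ?_ (fun i => ?_) i j hij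
        · refine Fin.cases ?_ (fun j _ => ?_)
          · intro h; exact absurd h (lt_irrefl _)
          · rw [Fin.cons_zero, Fin.cons_succ]; exact (h1 j).1
        · refine Fin.cases ?_ (fun j hij => ?_)
          · intro h; exact absurd h (Fin.not_lt_zero _)
          · rw [Fin.cons_succ, Fin.cons_succ]; exact h2 (Fin.succ_lt_succ_iff.1 hij)
    · intro m _
      exact Fin.cons_self_tail (n := u.length) (α := fun _ => ℕ) m
    · rintro ⟨n, m⟩ _
      rfl
    · intro m _
      exact Fin.prod_univ_succ (n := u.length) (fun i => g ((a :: u).get i) (m i))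

theorem truncSum_append_singleton (u : Index) (b : ℕ+) (M : ℕ) :
    truncSum g N (u ++ [b]) M = ∑ n ∈ Finset.Ioc M N, g b n * truncSum g (n - 1) u M := by
  induction u generalizing M with
  | nil => simp [truncSum]
  | cons a u ih =>
    rw [List.cons_append, truncSum]
    simp only [ih, truncSum, Finset.mul_sum]
    refine (Finset.sum_comm' (t' := Finset.Ioc M N)
      (s' := fun n => Finset.Ioc M (n - 1)) ?_).trans ?_
    · intro x y
      simp only [Finset.mem_Ioc]
      omega
    · refine Finset.sum_congr rfl fun n _ => Finset.sum_congr rfl fun m _ => ?_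
      ring

end

/-- The antipode relation in depth three, for maps compatible with the harmonic product. -/
theorem antipode_of_stuffle {R : Type*} [CommRing R] (S : Index → R)
    (hS : ∀ u v, S u * S v = ((stuffle u v).map S).sum) (a b c : ℕ+) :
    S [a, b, c] - S [c, b, a] = S [a, b] * S [c] - S [a] * (S [c, b] + S [c + b]) +
      S [c + b, a] + S [c, b + a] + S [a + b + c] := by
  -- The terms (a,c,b), (c,a,b) and (a+c,b) occur in both of the first two products and cancel in
  -- their difference. The leftover (a,b+c) is eliminated by the third product.
  have e1 := hS [a, b] [c]
  have e2 := hS [c, b] [a]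
  have e3 := hS [a] [c + b]
  simp only [stuffle, List.map_cons, List.map_nil, List.nil_append,
    List.cons_append, List.sum_cons, List.sum_nil] at e1 e2 e3
  rw [show a + (c + b) = a + b + c by rw [add_comm c b, add_assoc]] at e3
  rw [add_comm c b] at e3 ⊢
  rw [add_comm c a] at e2
  linear_combination -e1 + e2 + e3

/-! ### Real truncated sums and their growth. -/

/-- The weight `n⁻ᵃ`. -/
noncomputable def invPow (a : ℕ+) (n : ℕ) : ℝ := ((n : ℝ) ^ (a : ℕ))⁻¹

theorem invPow_add (a b : ℕ+) (n : ℕ) : invPow (a + b) n = invPow a n * invPow b n := by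
  simp [invPow, pow_add, mul_comm]

theorem invPow_nonneg (a : ℕ+) (n : ℕ) : 0 ≤ invPow a n := by
  unfold invPow; positivity

theorem invPow_le {a b : ℕ+} (h : a ≤ b) (n : ℕ) : invPow b n ≤ invPow a n := by
  unfold invPow
  rcases Nat.eq_zero_or_pos n with rfl | hn
  · simp
  · refine inv_anti₀ (by positivity) (pow_le_pow_right₀ (by exact_mod_cast hn) h)

/-- The truncation of `ζ(k)` at `N`. -/
noncomputable def mhs (N : ℕ) (k : Index) : ℝ := truncSum invPow N k 0

theorem truncSum_invPow_nonneg (N : ℕ) (u : Index) (M : ℕ) : 0 ≤ truncSum invPow N u M := by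
  induction u generalizing M with
  | nil => simp [truncSum]
  | cons a u ih => exact Finset.sum_nonneg fun n _ => mul_nonneg (invPow_nonneg _ _) (ih n)

theorem mhs_nonneg (N : ℕ) (k : Index) : 0 ≤ mhs N k := truncSum_invPow_nonneg N k 0

theorem mhs_singleton (N : ℕ) (a : ℕ+) : mhs N [a] = ∑ n ∈ Finset.Ioc 0 N, invPow a n := by
  simp [mhs, truncSum]

theorem mhs_append_singleton (N : ℕ) (u : Index) (b : ℕ+) :
    mhs N (u ++ [b]) = ∑ n ∈ Finset.Ioc 0 N, invPow b n * mhs (n - 1) u :=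
  truncSum_append_singleton _ _ _ _ _

theorem truncSum_invPow_le (N : ℕ) (u : Index) (M : ℕ) :
    truncSum invPow N u M ≤ mhs N [1] ^ u.length := by
  induction u generalizing M with
  | nil => simp [truncSum]
  | cons a u ih =>
    rw [truncSum, List.length_cons, pow_succ', mhs_singleton, Finset.sum_mul, ← mhs_singleton]
    refine (Finset.sum_le_sum fun n _ => mul_le_mul (invPow_le (one_le) n) (ih n)
      (truncSum_invPow_nonneg _ _ _) (invPow_nonneg _ _)).trans ?_
    refine Finset.sum_le_sum_of_subset_of_nonneg (Finset.Ioc_subset_Ioc_left (Nat.zero_le _)) ?_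
    intro n _ _
    exact mul_nonneg (invPow_nonneg _ _) (pow_nonneg (mhs_nonneg _ _) _)

theorem mhs_le (N : ℕ) (u : Index) : mhs N u ≤ mhs N [1] ^ u.length := truncSum_invPow_le N u 0

theorem mhs_one_eq_harmonic (N : ℕ) : mhs N [1] = harmonic N := by
  rw [mhs_singleton, harmonic_eq_sum_Icc]
  push_cast
  rw [show Finset.Ioc 0 N = Finset.Icc 1 N from rfl]
  simp [invPow]

theorem mhs_one_mono : Monotone fun N => mhs N [1] := by
  intro N M h
  simp only [mhs_singleton]
  exact Finset.sum_le_sum_of_subset_of_nonneg (Finset.Ioc_subset_Ioc_right h)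
    fun n _ _ => invPow_nonneg _ _

theorem tendsto_mhs_one : Tendsto (fun N => mhs N [1]) atTop atTop := by
  have h : Tendsto (fun N : ℕ => Real.log ((N + 1 : ℕ) : ℝ)) atTop atTop :=
    Real.tendsto_log_atTop.comp (tendsto_natCast_atTop_atTop.comp (tendsto_add_atTop_nat 1))
  refine tendsto_atTop_mono (fun N => ?_) h
  rw [mhs_one_eq_harmonic]
  exact log_add_one_le_harmonic N

theorem summable_invPow_two_mul_mhs_pow (s : ℕ) :
    Summable fun n => invPow 2 n * mhs n [1] ^ s := by
  have hs : Summable fun n : ℕ => (3 + 2 * (s : ℝ)) ^ s * (1 / (n : ℝ) ^ (3 / 2 : ℝ)) :=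
    (Real.summable_one_div_nat_rpow.2 (by norm_num)).mul_left _
  refine Summable.of_nonneg_of_le
    (fun n => mul_nonneg (invPow_nonneg _ _) (pow_nonneg (mhs_nonneg _ _) _)) (fun n => ?_) hs
  rcases Nat.eq_zero_or_pos n with rfl | hn
  · simp [invPow]
  have hn1 : (1 : ℝ) ≤ n := by exact_mod_cast hn
  have hn0 : (0 : ℝ) < n := by positivity
  -- This ε gives ε s ≤ 1/2, so H_n ^ s costs at most a factor n^(1/2). The constant 3 + 2s is 1 +
  -- 1/ε, from H_n ≤ 1 + log n ≤ 1 + n^ε / ε and 1 ≤ n^ε.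
  set ε : ℝ := 1 / (2 * (s + 1)) with hε
  have hε0 : 0 < ε := by positivity
  have h1 : mhs n [1] ≤ (3 + 2 * (s : ℝ)) * (n : ℝ) ^ ε := by
    rw [mhs_one_eq_harmonic]
    refine (harmonic_le_one_add_log n).trans ?_
    have := Real.log_le_rpow_div hn0.le hε0
    have h2 : (1 : ℝ) ≤ (n : ℝ) ^ ε := Real.one_le_rpow hn1 hε0.le
    have h3 : (n : ℝ) ^ ε / ε = (2 + 2 * (s : ℝ)) * (n : ℝ) ^ ε := by
      rw [hε]; field_simp; ring
    rw [h3] at this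
    linarith
  have h2 : mhs n [1] ^ s ≤ (3 + 2 * (s : ℝ)) ^ s * (n : ℝ) ^ (1 / 2 : ℝ) := by
    refine (pow_le_pow_left₀ (mhs_nonneg _ _) h1 s).trans ?_
    rw [mul_pow]
    refine mul_le_mul_of_nonneg_left ?_ (by positivity)
    rw [← Real.rpow_natCast, ← Real.rpow_mul hn0.le]
    refine Real.rpow_le_rpow_of_exponent_le hn1 ?_
    rw [hε, div_mul_eq_mul_div, div_le_div_iff₀ (by positivity) (by norm_num)]
    linarith
  refine (mul_le_mul_of_nonneg_left h2 (invPow_nonneg _ _)).trans (le_of_eq ?_)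
  have h3 : invPow 2 n = (n : ℝ) ^ (-2 : ℝ) := by
    rw [Real.rpow_neg hn0.le, invPow]; norm_num
  rw [h3, one_div ((n : ℝ) ^ (3 / 2 : ℝ)), ← Real.rpow_neg hn0.le, mul_left_comm,
    ← Real.rpow_add hn0]
  norm_num

/-! ### Convergence of multiple zeta values -/

/-- The boxes of tuples with entries at most N exhaust the index set, and the sum over such a box is
`mhs N k`. As the terms are nonnegative, a bound on the boxes gives summability and convergence
along them. -/
theorem mzv_of_bounded {k : Index} {C : ℝ} (hC : ∀ N, mhs N k ≤ C) :
    (Summable fun m : {m : Fin k.length → ℕ+ // StrictMono m} =>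
      ∏ i, (((m.1 i : ℕ) : ℝ) ^ (k.get i : ℕ))⁻¹) ∧
    Tendsto (fun N => mhs N k) atTop (𝓝 (mzv k)) := by
  classical
  set F : {m : Fin k.length → ℕ+ // StrictMono m} → ℝ := fun m =>
      ∏ i, (((m.1 i : ℕ) : ℝ) ^ (k.get i : ℕ))⁻¹ with hF
  have hF0 : ∀ m, 0 ≤ F m := fun m => Finset.prod_nonneg fun i _ => by positivity
  let φ : {m : Fin k.length → ℕ+ // StrictMono m} → (Fin k.length → ℕ) := fun m i => m.1 i
  have hφ : Function.Injective φ := by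
    intro m m' h
    refine Subtype.ext (funext fun i => PNat.coe_injective (congrFun h i))
  let B : ℕ → Finset (Fin k.length → ℕ) := fun N =>
    (Fintype.piFinset fun _ : Fin k.length => Finset.Ioc 0 N).filter (fun m => StrictMono m)
  let T : ℕ → Finset {m : Fin k.length → ℕ+ // StrictMono m} := fun N =>
    (B N).preimage φ hφ.injOn
  have hT : ∀ N, ∑ m ∈ T N, F m = mhs N k := by
    intro N
    rw [mhs, ← sum_strictMono_eq_truncSum invPow N k 0 inferInstance]
    refine Finset.sum_preimage φ (B N) hφ.injOn
      (fun m => ∏ i, invPow (k.get i) (m i)) fun m hm hm' => ?_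
    exfalso
    refine hm' ?_
    simp only [B, Finset.mem_filter, Fintype.mem_piFinset, Finset.mem_Ioc] at hm
    exact ⟨⟨fun i => ⟨m i, (hm.1 i).1⟩, fun i j h => hm.2 h⟩, rfl⟩
  have hmono : Monotone T := by
    intro N M h m hm
    simp only [T, B, Finset.mem_preimage, Finset.mem_filter, Fintype.mem_piFinset,
      Finset.mem_Ioc] at hm ⊢
    exact ⟨fun i => ⟨(hm.1 i).1, (hm.1 i).2.trans h⟩, hm.2⟩
  have hex : ∀ m, ∃ N, m ∈ T N := by
    intro m
    refine ⟨∑ i, φ m i, ?_⟩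
    simp only [T, B, Finset.mem_preimage, Finset.mem_filter, Fintype.mem_piFinset,
      Finset.mem_Ioc]
    exact ⟨fun i => ⟨(m.1 i).pos,
      Finset.single_le_sum (f := φ m) (fun _ _ => Nat.zero_le _) (Finset.mem_univ i)⟩,
      fun i j h => m.2 h⟩
  have hTt : Tendsto T atTop atTop := tendsto_atTop_finset_of_monotone hmono hex
  have hsum : Summable F := by
    refine summable_of_sum_le hF0 (c := C) fun s => ?_
    obtain ⟨N, hN⟩ := (hTt.eventually (eventually_ge_atTop s)).exists
    exact (Finset.sum_le_sum_of_subset_of_nonneg hN fun _ _ _ => hF0 _).trans ((hT N).le.trans (hC N))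
  refine ⟨hsum, ?_⟩
  have := hsum.hasSum.comp hTt
  refine this.congr fun N => hT N

/-- Sequences negligible against all powers of the harmonic numbers. -/
def Negl (e : ℕ → ℝ) : Prop := ∀ j : ℕ, Tendsto (fun N => e N * mhs N [1] ^ j) atTop (𝓝 0)

theorem admissible_cases {k : Index} (hk : Admissible k) :
    k = [] ∨ ∃ u b, k = u ++ [b] ∧ 2 ≤ b := by
  induction k using List.reverseRecOn with
  | nil => exact Or.inl rfl
  | append_singleton u b _ => exact Or.inr ⟨u, b, rfl, hk b (by simp)⟩

theorem sum_Ioc_zero_eq_sum_range (f : ℕ → ℝ) (hf : f 0 = 0) (N : ℕ) :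
    ∑ n ∈ Finset.Ioc 0 N, f n = ∑ n ∈ Finset.range (N + 1), f n := by
  refine Finset.sum_subset (fun n hn => ?_) fun n hn hn' => ?_
  · simp only [Finset.mem_Ioc, Finset.mem_range] at hn ⊢
    omega
  · simp only [Finset.mem_Ioc, Finset.mem_range] at hn hn'
    rw [show n = 0 by omega, hf]

theorem invPow_zero (a : ℕ+) : invPow a 0 = 0 := by simp [invPow]

/-- Sum by the largest variable n: the rest contributes at most a power of H_n, and n⁻² times any
power of H_n is summable. This gives convergence together with the negligible error. -/
theorem hasSum_mzv_append_singleton (u : Index) {b : ℕ+} (hb : 2 ≤ b) :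
    (Summable fun m : {m : Fin (u ++ [b]).length → ℕ+ // StrictMono m} =>
      ∏ i, (((m.1 i : ℕ) : ℝ) ^ ((u ++ [b]).get i : ℕ))⁻¹) ∧
    HasSum (fun n => invPow b n * mhs (n - 1) u) (mzv (u ++ [b])) ∧
    Negl fun N => mhs N (u ++ [b]) - mzv (u ++ [b]) := by
  set a : ℕ → ℝ := fun n => invPow b n * mhs (n - 1) u with ha
  have ha0 : ∀ n, 0 ≤ a n := fun n => mul_nonneg (invPow_nonneg _ _) (mhs_nonneg _ _)
  have hle : ∀ n, a n ≤ invPow 2 n * mhs n [1] ^ u.length := fun n =>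
    mul_le_mul (invPow_le hb n) ((mhs_le _ _).trans
      (pow_le_pow_left₀ (mhs_nonneg _ _) (mhs_one_mono (Nat.sub_le _ _)) _))
      (mhs_nonneg _ _) (invPow_nonneg _ _)
  have hsj : ∀ j, Summable fun n => a n * mhs n [1] ^ j := fun j => by
    refine Summable.of_nonneg_of_le (fun n => mul_nonneg (ha0 n) (pow_nonneg (mhs_nonneg _ _) _))
      (fun n => ?_) (summable_invPow_two_mul_mhs_pow (u.length + j))
    rw [pow_add, ← mul_assoc]
    exact mul_le_mul_of_nonneg_right (hle n) (pow_nonneg (mhs_nonneg _ _) _)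
  have hs : Summable a := by simpa using hsj 0
  have hH : ∀ N, mhs N (u ++ [b]) = ∑ n ∈ Finset.range (N + 1), a n := fun N => by
    rw [mhs_append_singleton, ← sum_Ioc_zero_eq_sum_range a (by simp [ha, invPow_zero])]
  obtain ⟨h1, h2⟩ := mzv_of_bounded (k := u ++ [b]) (C := ∑' n, a n) fun N => by
    rw [hH]; exact hs.sum_le_tsum _ fun n _ => ha0 n
  have hz : mzv (u ++ [b]) = ∑' n, a n := by
    refine tendsto_nhds_unique h2 ?_
    simp only [hH]
    exact (tendsto_add_atTop_iff_nat 1).2 hs.hasSum.tendsto_sum_nat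
  refine ⟨h1, hz ▸ hs.hasSum, fun j => ?_⟩
  have hdiff : ∀ N, mhs N (u ++ [b]) - mzv (u ++ [b]) = - ∑' n, a (n + (N + 1)) := fun N => by
    rw [hH, hz, ← hs.sum_add_tsum_nat_add (N + 1)]; ring
  -- Since H_N ≤ H_n for n > N, the factor H_N ^ j may be moved into the tail as H_n ^ j; the result
  -- is the tail of a convergent series.
  have hlim : Tendsto (fun N => - ∑' n, a (n + (N + 1)) * mhs (n + (N + 1)) [1] ^ j) atTop
      (𝓝 0) := by
    have := (tendsto_add_atTop_iff_nat 1).2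
      (_root_.tendsto_sum_nat_add fun n => a n * mhs n [1] ^ j)
    simpa using this.neg
  refine tendsto_of_tendsto_of_tendsto_of_le_of_le hlim tendsto_const_nhds ?_ ?_
  · intro N
    simp only
    rw [hdiff, neg_mul, neg_le_neg_iff, ← tsum_mul_right]
    have s1 : Summable fun n => a (n + (N + 1)) := (summable_nat_add_iff (N + 1)).2 hs
    have s2 : Summable fun n => a (n + (N + 1)) * mhs (n + (N + 1)) [1] ^ j :=
      (summable_nat_add_iff (f := fun n => a n * mhs n [1] ^ j) (N + 1)).2 (hsj j)
    refine Summable.tsum_le_tsum (fun n => ?_) (s1.mul_right _) s2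
    exact mul_le_mul_of_nonneg_left (pow_le_pow_left₀ (mhs_nonneg _ _)
      (mhs_one_mono (by omega)) _) (ha0 _)
  · intro N
    simp only
    rw [hdiff, neg_mul, neg_nonpos]
    exact mul_nonneg (tsum_nonneg fun n => ha0 _) (pow_nonneg (mhs_nonneg _ _) _)

theorem mhs_sub_mzv_negl {k : Index} (hk : Admissible k) : Negl fun N => mhs N k - mzv k := by
  rcases admissible_cases hk with rfl | ⟨u, b, rfl, hb⟩
  · have h : ∀ N, mhs N [] = 1 := fun N => rfl
    obtain ⟨-, h2⟩ := mzv_of_bounded (k := []) (C := 1) fun N => (h N).le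
    have : mzv [] = 1 := tendsto_nhds_unique h2 (by simp only [h]; exact tendsto_const_nhds)
    intro j
    simp [h, this]
  · exact (hasSum_mzv_append_singleton u hb).2.2

/-! ### Truncated sums on ℌ¹. -/

/-- The `ℚ`-linear extension of `mhs N` to `ℌ¹`. -/
noncomputable def mhsLin (N : ℕ) : H1 →ₗ[ℚ] ℝ := Finsupp.linearCombination ℚ (mhs N)

theorem mhsLin_word (N : ℕ) (u : Index) : mhsLin N (word u) = mhs N u := by
  simp [mhsLin, word]

theorem mhs_mul (N : ℕ) (u v : Index) :
    mhs N u * mhs N v = ((stuffle u v).map (mhs N)).sum :=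
  truncSum_mul invPow N invPow_add u v 0

theorem map_sum_words {M : Type*} [AddCommGroup M] [Module ℚ M] (f : H1 →ₗ[ℚ] M)
    (l : List Index) : f (l.map word).sum = (l.map fun u => f (word u)).sum := by
  rw [map_list_sum, List.map_map]; rfl

theorem mhsLin_harmWord (N : ℕ) (u v : Index) :
    mhsLin N (harmWord u v) = mhs N u * mhs N v := by
  rw [harmWord_eq_stuffle, map_sum_words, mhs_mul]
  simp only [mhsLin_word]

theorem mhsLin_mulE1 (N : ℕ) (x : H1) : mhsLin N (mulE1 x) = mhsLin N x * mhs N [1] := by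
  induction x using Finsupp.induction_linear with
  | zero => simp
  | add x y hx hy => rw [map_add, map_add, hx, hy, map_add, add_mul]
  | single u q =>
    have : (Finsupp.single u q : H1) = q • word u := by simp [word]
    rw [this, map_smul, map_smul, mulE1_word, mhsLin_harmWord, map_smul, mhsLin_word,
      smul_mul_assoc]

theorem mhsLin_mulE1_pow (N i : ℕ) (x : H1) :
    mhsLin N ((mulE1 ^ i) x) = mhsLin N x * mhs N [1] ^ i := by
  induction i with
  | zero => simp
  | succ i ih => rw [pow_succ', Module.End.mul_apply, mhsLin_mulE1, ih, pow_succ, mul_assoc]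

/-! ### Negligible sequences -/

theorem Negl.zero : Negl fun _ => 0 := fun j => by simp

theorem Negl.add {e f : ℕ → ℝ} (he : Negl e) (hf : Negl f) : Negl fun N => e N + f N :=
  fun j => by simpa [add_mul] using (he j).add (hf j)

theorem Negl.const_mul {e : ℕ → ℝ} (he : Negl e) (c : ℝ) : Negl fun N => c * e N :=
  fun j => by simpa [mul_assoc] using (he j).const_mul c

theorem Negl.mul_pow {e : ℕ → ℝ} (he : Negl e) (i : ℕ) : Negl fun N => e N * mhs N [1] ^ i :=
  fun j => by simpa [mul_assoc, pow_add] using he (i + j)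

theorem Negl.mul {e f : ℕ → ℝ} (he : Negl e) (hf : Negl f) : Negl fun N => e N * f N :=
  fun j => by simpa [mul_assoc, mul_comm, mul_left_comm] using (he j).mul (hf 0)

theorem Negl.mul_poly {e : ℕ → ℝ} (he : Negl e) (P : Polynomial ℝ) :
    Negl fun N => e N * P.eval (mhs N [1]) := by
  induction P using Polynomial.induction_on' with
  | add p q hp hq => simpa [mul_add] using hp.add hq
  | monomial n a =>
    simpa [mul_left_comm] using (he.mul_pow n).const_mul a

/-- `P` is the asymptotic expansion of the truncated sums of `x` in powers of harmonic numbers. -/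
def Asym (x : H1) (P : Polynomial ℝ) : Prop :=
  Negl fun N => mhsLin N x - P.eval (mhs N [1])

theorem Asym.add {x y : H1} {P Q : Polynomial ℝ} (hx : Asym x P) (hy : Asym y Q) :
    Asym (x + y) (P + Q) := by
  have h := Negl.add hx hy
  unfold Asym
  convert h using 2
  rw [map_add, Polynomial.eval_add]; ring

theorem Asym.smul {x : H1} {P : Polynomial ℝ} (hx : Asym x P) (q : ℚ) :
    Asym (q • x) (Polynomial.C (q : ℝ) * P) := by
  have h := Negl.const_mul hx (q : ℝ)
  unfold Asym
  convert h using 2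
  rw [map_smul, Polynomial.eval_mul, Polynomial.eval_C, Rat.smul_def]; ring

theorem Asym.mulE1_pow {x : H1} {P : Polynomial ℝ} (hx : Asym x P) (i : ℕ) :
    Asym ((mulE1 ^ i) x) (P * Polynomial.X ^ i) := by
  have h := Negl.mul_pow hx i
  unfold Asym
  convert h using 2
  rw [mhsLin_mulE1_pow, Polynomial.eval_mul, Polynomial.eval_pow, Polynomial.eval_X]; ring

/-- With errors e and f, the product differs from P Q by e Q + f P + e f. This is why negligibility
is required against all powers of H_N. -/
theorem Asym.harmWord {u v : Index} {P Q : Polynomial ℝ} (hu : Asym (word u) P)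
    (hv : Asym (word v) Q) : Asym (harmWord u v) (P * Q) := by
  have h := ((Negl.mul_poly hu Q).add (Negl.mul_poly hv P)).add (Negl.mul hu hv)
  unfold Asym
  convert h using 2
  rw [mhsLin_harmWord, mhsLin_word, mhsLin_word, Polynomial.eval_mul]; ring

theorem Asym.zero : Asym 0 0 := by
  unfold Asym; simpa using Negl.zero

theorem Asym.sum {ι : Type*} {x : ι → H1} {P : ι → Polynomial ℝ} (s : Finset ι)
    (h : ∀ i ∈ s, Asym (x i) (P i)) : Asym (∑ i ∈ s, x i) (∑ i ∈ s, P i) := by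
  classical
  induction s using Finset.induction_on with
  | empty => simpa using Asym.zero
  | insert i s hi ih =>
    rw [Finset.sum_insert hi, Finset.sum_insert hi]
    exact (h i (by simp)).add (ih fun j hj => h j (by simp [hj]))

/-- H_N tends to infinity, so a polynomial whose values at H_N tend to 0 is the zero polynomial. -/
theorem Asym.unique {x : H1} {P Q : Polynomial ℝ} (hP : Asym x P) (hQ : Asym x Q) : P = Q := by
  have h : Tendsto (fun N => (P - Q).eval (mhs N [1])) atTop (𝓝 0) := by
    have := ((Negl.add hP (Negl.const_mul hQ (-1))) 0).neg
    simp only [pow_zero, mul_one, neg_zero] at this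
    refine this.congr fun N => ?_
    rw [Polynomial.eval_sub]; ring
  rw [← sub_eq_zero]
  by_cases hd : 0 < (P - Q).degree
  · have h1 := (Polynomial.abs_tendsto_atTop (P - Q) hd).comp tendsto_mhs_one
    have h2 := h.abs
    exact absurd h2 (not_tendsto_nhds_of_tendsto_atTop h1 _)
  · rw [Polynomial.eq_C_of_degree_le_zero (not_lt.1 hd)] at h ⊢
    simp only [Polynomial.eval_C] at h
    rw [tendsto_nhds_unique tendsto_const_nhds h, map_zero]

/-! ### Regularized values as constant terms of asymptotic expansions. -/

theorem Zmap_word {k : Index} (hk : Admissible k) : Zmap (word k) = mzvZ k hk := by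
  simp [Zmap, word, hk]

theorem asym_of_mem_H0 {x : H1} (hx : x ∈ H0) : Asym x (Polynomial.C ((Zmap x : MZVAlg) : ℝ)) := by
  rw [mem_H0_iff] at hx
  refine induction_trailLe (P := fun x => Asym x (Polynomial.C ((Zmap x : MZVAlg) : ℝ))) x hx ?_ ?_ ?_
  · simpa using Asym.zero
  · intro x y hx hy
    simpa using hx.add hy
  · intro q u hu
    have hu' : Admissible u := (admissible_iff_trail u).2 (by omega)
    have h : Asym (word u) (Polynomial.C (mzv u)) := by
      unfold Asym
      simpa [mhsLin_word] using mhs_sub_mzv_negl hu'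
    have := h.smul q
    rwa [← map_mul, ← Rat.smul_def, show q • mzv u = ((Zmap (q • word u) : MZVAlg) : ℝ) by
      rw [map_smul, Zmap_word hu']; rfl] at this

/-- The regularized value is the constant term of the asymptotic expansion. -/
theorem exists_asym (x : H1) : ∃ P, Asym x P ∧ P.eval 0 = ((Zmap (reg x) : MZVAlg) : ℝ) := by
  obtain ⟨N, c, hc, hr⟩ := reg_spec x
  refine ⟨∑ i ∈ Finset.range (N + 1), Polynomial.C ((Zmap (c i) : MZVAlg) : ℝ) * Polynomial.X ^ i,
    ?_, ?_⟩
  · conv => rw [hc.2]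
    exact Asym.sum _ fun i _ => (asym_of_mem_H0 (hc.1 i)).mulE1_pow i
  · rw [hr, Polynomial.eval_finsetSum, Finset.sum_range_succ']
    simp

theorem Zmap_reg_eq {x : H1} {P : Polynomial ℝ} (h : Asym x P) :
    ((Zmap (reg x) : MZVAlg) : ℝ) = P.eval 0 := by
  obtain ⟨Q, hQ, h0⟩ := exists_asym x
  rw [h.unique hQ, h0]

/-- `reg` is defined by a choice of expansion. Additivity is needed only after applying `Zmap`,
where it follows from uniqueness of the asymptotic polynomial. -/
theorem Zmap_reg_add (x y : H1) : Zmap (reg (x + y)) = Zmap (reg x) + Zmap (reg y) := by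
  obtain ⟨P, hP, h1⟩ := exists_asym x
  obtain ⟨Q, hQ, h2⟩ := exists_asym y
  refine Subtype.ext ?_
  rw [Zmap_reg_eq (hP.add hQ), Polynomial.eval_add, h1, h2]; rfl

theorem Zmap_reg_sum (l : List Index) :
    Zmap (reg (l.map word).sum) = (l.map zetaHarm).sum := by
  induction l with
  | nil =>
    refine Subtype.ext ?_
    rw [List.map_nil, List.sum_nil, Zmap_reg_eq Asym.zero]; simp
  | cons u l ih => rw [List.map_cons, List.sum_cons, Zmap_reg_add, ih]; rfl

/-- Harmonic regularized values multiply according to the harmonic product. -/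
theorem zetaHarm_mul (u v : Index) :
    zetaHarm u * zetaHarm v = ((stuffle u v).map zetaHarm).sum := by
  rw [← Zmap_reg_sum, ← harmWord_eq_stuffle]
  obtain ⟨P, hP, h1⟩ := exists_asym (word u)
  obtain ⟨Q, hQ, h2⟩ := exists_asym (word v)
  refine Subtype.ext ?_
  rw [Zmap_reg_eq (hP.harmWord hQ), Polynomial.eval_mul, h1, h2]; rfl

theorem zetaHarm_admissible {k : Index} (hk : Admissible k) : zetaHarm k = mzvZ k hk := by
  have h := asym_of_mem_H0 (word_mem hk : word k ∈ H0)
  refine Subtype.ext ?_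
  rw [zetaHarm, Zmap_reg_eq h, Polynomial.eval_C, Zmap_word hk]

theorem zetaHarm_nil : zetaHarm [] = 1 := by
  have h : Asym (word []) 1 := by
    unfold Asym
    simpa [mhsLin_word, mhs, truncSum] using Negl.zero
  refine Subtype.ext ?_
  rw [zetaHarm, Zmap_reg_eq h, Polynomial.eval_one]; rfl

/-! ### Double zeta values: partial fractions and the sum formula -/

/-- Pascal's rule for the coefficients; this and the next two lemmas are the inductive step and the
boundary cases of `partial_fraction`. -/
theorem partial_fraction_step {R : Type*} [CommSemiring R] (t w : R) (a b : ℕ) :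
    ∑ q ∈ antidiagonal (a + 1 + (b + 1)),
        (q.2.choose (a + 1) : R) * (t ^ (q.1 + 1) * w ^ (q.2 + 1)) =
      w * (∑ q ∈ antidiagonal (a + (b + 1)),
        (q.2.choose a : R) * (t ^ (q.1 + 1) * w ^ (q.2 + 1)) +
        ∑ q ∈ antidiagonal (a + 1 + b),
        (q.2.choose (a + 1) : R) * (t ^ (q.1 + 1) * w ^ (q.2 + 1))) := by
  rw [show a + (b + 1) = a + 1 + b by ring, ← Finset.sum_add_distrib, Finset.mul_sum,
    ← add_assoc, Finset.Nat.sum_antidiagonal_succ']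
  simp only [Nat.choose_zero_succ, Nat.cast_zero, zero_mul, zero_add]
  refine Finset.sum_congr rfl fun q _ => ?_
  rw [Nat.choose_succ_succ]; push_cast; ring

theorem partial_fraction_zero {R : Type*} [CommSemiring R] (t w : R) (b : ℕ) :
    ∑ q ∈ antidiagonal (0 + (b + 1)),
        (q.2.choose 0 : R) * (t ^ (q.1 + 1) * w ^ (q.2 + 1)) =
      w * (t ^ (b + 2) +
        ∑ q ∈ antidiagonal (0 + b),
        (q.2.choose 0 : R) * (t ^ (q.1 + 1) * w ^ (q.2 + 1))) := by
  rw [zero_add, zero_add, Finset.Nat.sum_antidiagonal_succ', mul_add, Finset.mul_sum]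
  simp only [Nat.choose_zero_right, Nat.cast_one, one_mul]
  congr 1
  · ring
  · refine Finset.sum_congr rfl fun q _ => ?_
    ring

theorem partial_fraction_top {R : Type*} [CommSemiring R] (t w : R) (a : ℕ) :
    ∑ q ∈ antidiagonal (a + 0),
        (q.2.choose a : R) * (t ^ (q.1 + 1) * w ^ (q.2 + 1)) =
      t * w ^ (a + 1) := by
  rw [Finset.sum_eq_single (0, a)]
  · simp
  · rintro ⟨i, j⟩ h hne
    simp only [mem_antidiagonal] at h
    have : j < a := by
      by_contra hj
      exact hne (by ext <;> simp <;> omega)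
    simp [Nat.choose_eq_zero_of_lt this]
  · simp

/-- Partial fractions, in the form satisfied by `u = 1/x`, `v = 1/y`, `w = 1/(x+y)`. -/
theorem partial_fraction {R : Type*} [CommSemiring R] {u v w : R} (h : u * v = w * (u + v))
    (a b : ℕ) : u ^ (a + 1) * v ^ (b + 1) =
      ∑ q ∈ antidiagonal (a + b), (q.2.choose a : R) * (v ^ (q.1 + 1) * w ^ (q.2 + 1)) +
      ∑ q ∈ antidiagonal (b + a), (q.2.choose b : R) * (u ^ (q.1 + 1) * w ^ (q.2 + 1)) := by
  -- One use of the relation between u, v and w lowers the degree in u and v by one, so both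
  -- exponents can be driven down by induction. No subtraction is used, so the identity also holds
  -- in [0, ∞].
  have step : ∀ a b : ℕ, u ^ (a + 1) * v ^ (b + 1) =
      w * (u ^ a * v ^ (b + 1) + u ^ (a + 1) * v ^ b) := fun a b => by
    calc u ^ (a + 1) * v ^ (b + 1) = u ^ a * v ^ b * (u * v) := by ring
      _ = _ := by rw [h]; ring
  induction a generalizing b with
  | zero =>
    induction b with
    | zero => simp [h]; ring
    | succ b ih =>
      rw [step, ih, partial_fraction_zero, partial_fraction_top, partial_fraction_top]
      ring
  | succ a iha =>
    induction b with
    | zero =>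
      rw [step, iha, partial_fraction_zero, partial_fraction_top, partial_fraction_top]
      ring
    | succ b ihb =>
      rw [step, iha, ihb, partial_fraction_step, partial_fraction_step]
      ring

/-- The partial fraction behind the sum formula. Summing v^(e+1) u w directly over all pairs would
split a factor 1/x off a divergent series; keeping the product u w makes the inner sum converge. -/
theorem partial_fraction_one {R : Type*} [CommSemiring R] {u v w : R} (h : u * v = w * (u + v))
    (e : ℕ) : ∑ q ∈ antidiagonal e, v ^ (q.1 + 1) * w ^ (q.2 + 2) + u * w ^ (e + 2) =
      v ^ (e + 1) * (u * w) := by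
  induction e with
  | zero =>
    simp only [Finset.Nat.antidiagonal_zero, Finset.sum_singleton]
    calc _ = w * (w * (u + v)) := by ring
      _ = _ := by rw [← h]; ring
  | succ e ih =>
    rw [Finset.Nat.sum_antidiagonal_succ']
    have e1 : ∑ q ∈ antidiagonal e, v ^ (q.1 + 1) * w ^ (q.2 + 1 + 2) =
        w * ∑ q ∈ antidiagonal e, v ^ (q.1 + 1) * w ^ (q.2 + 2) := by
      rw [Finset.mul_sum]; exact Finset.sum_congr rfl fun q _ => by ring
    rw [e1]
    calc _ = w * (∑ q ∈ antidiagonal e, v ^ (q.1 + 1) * w ^ (q.2 + 2) + u * w ^ (e + 2))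
            + v ^ (e + 2) * w ^ 2 := by ring
      _ = w * v ^ (e + 1) * (w * (u + v)) := by rw [ih]; ring
      _ = _ := by rw [← h]; ring

open scoped ENNReal

/-- `1/n` in `[0, ∞]`. -/
noncomputable def einv (n : ℕ+) : ℝ≥0∞ := ENNReal.ofReal ((n : ℝ)⁻¹)

theorem einv_mul (x y : ℕ+) : einv x * einv y = einv (x + y) * (einv x + einv y) := by
  have hx : (0 : ℝ) < (x : ℝ) := by exact_mod_cast x.pos
  have hy : (0 : ℝ) < (y : ℝ) := by exact_mod_cast y.pos
  unfold einv
  rw [← ENNReal.ofReal_add (by positivity) (by positivity), ← ENNReal.ofReal_mul (by positivity),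
    ← ENNReal.ofReal_mul (by positivity)]
  congr 1
  push_cast
  field_simp
  ring

theorem einv_pow (n : ℕ+) (a : ℕ) :
    einv n ^ (a + 1) = ENNReal.ofReal (invPow a.succPNat n) := by
  rw [einv, ← ENNReal.ofReal_pow (by positivity), invPow, inv_pow]; rfl

/-- `ζ(a+1)` in `[0, ∞]`. -/
noncomputable def ezeta (a : ℕ) : ℝ≥0∞ := ∑' n : ℕ+, einv n ^ (a + 1)

/-- `ζ(i+1, j+1)` in `[0, ∞]`. -/
noncomputable def edzeta (i j : ℕ) : ℝ≥0∞ :=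
  ∑' p : ℕ+ × ℕ+, einv p.1 ^ (i + 1) * einv (p.1 + p.2) ^ (j + 1)

theorem edzeta_swap (i j : ℕ) :
    ∑' p : ℕ+ × ℕ+, einv p.2 ^ (i + 1) * einv (p.1 + p.2) ^ (j + 1) = edzeta i j := by
  rw [edzeta, ← (Equiv.prodComm ℕ+ ℕ+).tsum_eq]
  simp [add_comm]

/-- Apply partial fractions to 1/x, 1/y, 1/(x+y) and sum over all pairs. In [0, ∞] every
rearrangement is legitimate, even when terms such as `edzeta i 0` diverge. -/
theorem ezeta_mul_ezeta (a b : ℕ) : ezeta a * ezeta b =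
    ∑ q ∈ antidiagonal (a + b),
      ((q.2.choose a + q.2.choose b : ℕ) : ℝ≥0∞) * edzeta q.1 q.2 := by
  have e : ezeta a * ezeta b = ∑' p : ℕ+ × ℕ+, einv p.1 ^ (a + 1) * einv p.2 ^ (b + 1) := by
    rw [ENNReal.tsum_prod (f := fun x y => einv x ^ (a + 1) * einv y ^ (b + 1)), ezeta,
      ← ENNReal.tsum_mul_right]
    refine tsum_congr fun x => ?_
    rw [ezeta, ENNReal.tsum_mul_left]
  rw [e, tsum_congr fun p : ℕ+ × ℕ+ => partial_fraction (einv_mul p.1 p.2) a b,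
    ENNReal.tsum_add,
      Summable.tsum_finsetSum fun _ _ => ENNReal.summable,
    Summable.tsum_finsetSum fun _ _ => ENNReal.summable, add_comm b a, ← Finset.sum_add_distrib]
  refine Finset.sum_congr rfl fun q _ => ?_
  rw [ENNReal.tsum_mul_left, ENNReal.tsum_mul_left, edzeta_swap]
  push_cast
  rw [add_mul]; rfl

/-- Telescoping exchanges N terms for y terms. On the right the number of terms is fixed, so N → ∞
can be taken termwise and yields H_y. -/
theorem sum_range_inv_sub_inv (y N : ℕ) :
    ∑ x ∈ Finset.range N, (((x + 1 : ℕ) : ℝ)⁻¹ - ((x + 1 + y : ℕ) : ℝ)⁻¹) =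
      ∑ i ∈ Finset.range y, (((i + 1 : ℕ) : ℝ)⁻¹ - ((N + 1 + i : ℕ) : ℝ)⁻¹) := by
  induction y with
  | zero => simp
  | succ y ih =>
    rw [Finset.sum_range_succ, ← ih, ← sub_eq_iff_eq_add', ← Finset.sum_sub_distrib]
    have := Finset.sum_range_sub' (fun x : ℕ => ((x + 1 + y : ℕ) : ℝ)⁻¹) N
    simp only [zero_add] at this
    rw [add_comm 1 y] at this
    rw [← this]
    refine Finset.sum_congr rfl fun x _ => ?_
    rw [show x + 1 + (y + 1) = x + 1 + 1 + y by ring]; ring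

theorem tsum_einv_mul_einv (y : ℕ+) :
    ∑' x : ℕ+, einv x * einv (x + y) = einv y * ENNReal.ofReal (mhs y [1]) := by
  have hy : (0 : ℝ) < (y : ℝ) := by exact_mod_cast y.pos
  have hs : HasSum (fun x : ℕ => ((x + 1 : ℕ) : ℝ)⁻¹ - ((x + 1 + y : ℕ) : ℝ)⁻¹) (mhs y [1]) := by
    rw [hasSum_iff_tendsto_nat_of_nonneg]
    · simp only [sum_range_inv_sub_inv]
      have h1 : mhs y [1] = ∑ i ∈ Finset.range (y : ℕ), (((i + 1 : ℕ) : ℝ)⁻¹ - 0) := by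
        rw [mhs_one_eq_harmonic, harmonic]; push_cast; simp
      rw [h1]
      refine tendsto_finsetSum _ fun i _ => tendsto_const_nhds.sub ?_
      refine tendsto_inv_atTop_zero.comp (tendsto_natCast_atTop_atTop.comp ?_)
      exact (tendsto_add_atTop_nat i).comp (tendsto_add_atTop_nat 1)
    · intro x
      rw [sub_nonneg]
      exact inv_anti₀ (by positivity) (by push_cast; linarith)
  have e : ∀ x : ℕ, einv x.succPNat * einv (x.succPNat + y) =
      einv y * ENNReal.ofReal (((x + 1 : ℕ) : ℝ)⁻¹ - ((x + 1 + y : ℕ) : ℝ)⁻¹) := by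
    intro x
    unfold einv
    rw [← ENNReal.ofReal_mul (by positivity), ← ENNReal.ofReal_mul (by positivity)]
    congr 1
    push_cast [Nat.succPNat_coe]
    field_simp
    ring
  have hnn : ∀ x : ℕ, 0 ≤ ((x + 1 : ℕ) : ℝ)⁻¹ - ((x + 1 + y : ℕ) : ℝ)⁻¹ := fun x => by
    rw [sub_nonneg]
    exact inv_anti₀ (by positivity) (by push_cast; linarith)
  rw [← Equiv.pnatEquivNat.symm.tsum_eq]
  simp only [Equiv.pnatEquivNat_symm_apply, e]
  rw [ENNReal.tsum_mul_left, ← ENNReal.ofReal_tsum_of_nonneg hnn hs.summable, hs.tsum_eq]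

theorem tsum_pnat_ofReal {f : ℕ → ℝ} {s : ℝ} (hf : HasSum f s) (h0 : ∀ n, 0 ≤ f n)
    (hz : f 0 = 0) : ∑' n : ℕ+, ENNReal.ofReal (f n) = ENNReal.ofReal s := by
  have h : HasSum (fun n : ℕ+ => f n) s := by
    refine (PNat.coe_injective.hasSum_iff fun n hn => ?_).2 hf
    rcases Nat.eq_zero_or_pos n with rfl | hn'
    · exact hz
    · exact absurd ⟨⟨n, hn'⟩, rfl⟩ hn
  rw [← ENNReal.ofReal_tsum_of_nonneg (f := fun n : ℕ+ => f n) (fun n => h0 n) h.summable,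
    h.tsum_eq]

theorem two_le_succPNat {a : ℕ} (ha : 1 ≤ a) : 2 ≤ a.succPNat := by
  rw [← PNat.coe_le_coe, Nat.succPNat_coe]; exact Nat.succ_le_succ ha

theorem ezeta_eq {a : ℕ} (ha : 1 ≤ a) : ezeta a = ENNReal.ofReal (mzv [a.succPNat]) := by
  have h := (hasSum_mzv_append_singleton [] (two_le_succPNat ha)).2.1
  have e : ∀ n, mhs n [] = 1 := fun n => rfl
  simp only [e, mul_one, List.nil_append] at h
  rw [← tsum_pnat_ofReal h (invPow_nonneg _) (invPow_zero _), ezeta]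
  simp only [einv_pow]

/-- Pairs of positive integers as strictly increasing pairs. -/
def pairEquiv : ℕ+ × ℕ+ ≃ {m : Fin 2 → ℕ+ // StrictMono m} where
  toFun p := ⟨![p.1, p.1 + p.2], by
    intro i j h
    fin_cases i <;> fin_cases j <;> simp at h ⊢
    exact PNat.lt_add_right _ _⟩
  invFun m := (m.1 0, m.1 1 - m.1 0)
  left_inv p := by
    refine Prod.ext rfl (add_right_injective p.1 ?_)
    exact PNat.add_sub_of_lt (PNat.lt_add_right _ _)
  right_inv m := by
    refine Subtype.ext (funext fun i => ?_)
    fin_cases i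
    · rfl
    · exact PNat.add_sub_of_lt (m.2 (by decide))

theorem edzeta_eq (i : ℕ) {j : ℕ} (hj : 1 ≤ j) :
    edzeta i j = ENNReal.ofReal (mzv [i.succPNat, j.succPNat]) := by
  have h : Summable fun m : {m : Fin 2 → ℕ+ // StrictMono m} =>
      ∏ l, (((m.1 l : ℕ) : ℝ) ^ ([i.succPNat, j.succPNat].get l : ℕ))⁻¹ :=
    (hasSum_mzv_append_singleton [i.succPNat] (two_le_succPNat hj)).1
  have e : mzv [i.succPNat, j.succPNat] = ∑' m : {m : Fin 2 → ℕ+ // StrictMono m},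
      ∏ l, (((m.1 l : ℕ) : ℝ) ^ ([i.succPNat, j.succPNat].get l : ℕ))⁻¹ := rfl
  rw [e, ENNReal.ofReal_tsum_of_nonneg (fun m => Finset.prod_nonneg fun l _ => by positivity) h,
    ← pairEquiv.tsum_eq, edzeta]
  refine tsum_congr fun p => ?_
  rw [einv_pow, einv_pow, ← ENNReal.ofReal_mul (invPow_nonneg _ _)]
  congr 1
  exact (Fin.prod_univ_two fun l : Fin 2 =>
    ((((pairEquiv p).1 l : ℕ) : ℝ) ^ ([i.succPNat, j.succPNat].get l : ℕ))⁻¹).symm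

theorem mzv_nonneg (k : Index) : 0 ≤ mzv k :=
  tsum_nonneg fun _ => Finset.prod_nonneg fun _ _ => by positivity

theorem mhs_one_eq_pred_add (y : ℕ+) : mhs y [1] = mhs ((y : ℕ) - 1) [1] + invPow 1 y := by
  rw [mhs_singleton, mhs_singleton]
  have h : (y : ℕ) = (y : ℕ) - 1 + 1 := (Nat.succ_pred_eq_of_pos y.pos).symm
  conv_lhs => rw [h]
  rw [Finset.sum_Ioc_succ_top (Nat.zero_le _), ← h]

/-- The sum formula for double zeta values. -/
theorem sum_mzv_pair (e : ℕ) :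
    ∑ q ∈ antidiagonal e, mzv [q.1.succPNat, (q.2 + 1).succPNat] =
      mzv [(e + 2).succPNat] := by
  -- The sum of v^(e+1) u w over all pairs is computed twice. Partial fractions give the double zeta
  -- values together with ζ(1, e+2).
  have h1 : ∑ q ∈ antidiagonal e, edzeta q.1 (q.2 + 1) + edzeta 0 (e + 1) =
      ∑' p : ℕ+ × ℕ+, einv p.2 ^ (e + 1) * (einv p.1 * einv (p.1 + p.2)) := by
    rw [← tsum_congr fun p : ℕ+ × ℕ+ => partial_fraction_one (einv_mul p.1 p.2) e, ENNReal.tsum_add,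
      Summable.tsum_finsetSum fun _ _ => ENNReal.summable]
    congr 1
    · exact Finset.sum_congr rfl fun q _ => (edzeta_swap _ _).symm
    · simp [edzeta, add_assoc]
  -- Summing over x first gives H_y / y^(e+2), and H_y = H_{y-1} + 1/y separates ζ(1, e+2) from
  -- ζ(e+3). The common ζ(1, e+2) is cancelled at the end, in ℝ.
  have h2 : ∑' p : ℕ+ × ℕ+, einv p.2 ^ (e + 1) * (einv p.1 * einv (p.1 + p.2)) =
      ENNReal.ofReal (mzv [1, (e + 1).succPNat] + mzv [(e + 2).succPNat]) := by
    have hs1 := (hasSum_mzv_append_singleton [1] (two_le_succPNat (show 1 ≤ e + 1 by omega))).2.1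
    have hs2 := (hasSum_mzv_append_singleton [] (two_le_succPNat (show 1 ≤ e + 2 by omega))).2.1
    simp only [List.cons_append, List.nil_append] at hs1 hs2
    rw [← tsum_pnat_ofReal (hs1.add hs2)
      (fun n => add_nonneg (mul_nonneg (invPow_nonneg _ _) (mhs_nonneg _ _))
        (mul_nonneg (invPow_nonneg _ _) (mhs_nonneg _ _))) (by simp [invPow_zero]),
      ← (Equiv.prodComm ℕ+ ℕ+).tsum_eq]
    simp only [Equiv.prodComm_apply, Prod.fst_swap, Prod.snd_swap]
    rw [ENNReal.tsum_prod (f := fun y x => einv y ^ (e + 1) * (einv x * einv (x + y)))]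
    refine tsum_congr fun y => ?_
    rw [ENNReal.tsum_mul_left, tsum_einv_mul_einv, ← mul_assoc, ← pow_succ, einv_pow,
      ← ENNReal.ofReal_mul (invPow_nonneg _ _), mhs_one_eq_pred_add, mul_add, ← invPow_add]
    have e1 : (e + 1).succPNat + 1 = (e + 2).succPNat := PNat.eq (by simp)
    rw [e1]
    simp [mhs, truncSum]
  have h3 : ∀ q ∈ antidiagonal e, edzeta q.1 (q.2 + 1) =
      ENNReal.ofReal (mzv [q.1.succPNat, (q.2 + 1).succPNat]) := fun q _ =>
    edzeta_eq q.1 (by omega)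
  rw [h2, Finset.sum_congr rfl h3, edzeta_eq 0 (by omega),
    ← ENNReal.ofReal_sum_of_nonneg fun _ _ => mzv_nonneg _,
    ← ENNReal.ofReal_add (Finset.sum_nonneg fun _ _ => mzv_nonneg _) (mzv_nonneg _),
    ENNReal.ofReal_eq_ofReal_iff
      (add_nonneg (Finset.sum_nonneg fun _ _ => mzv_nonneg _) (mzv_nonneg _))
      (add_nonneg (mzv_nonneg _) (mzv_nonneg _)), add_comm] at h1
  exact add_left_cancel h1

/-- The product of two zeta values as a combination of double zeta values. -/
theorem mzv_mul_mzv {a b : ℕ} (ha : 1 ≤ a) (hb : 1 ≤ b) :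
    mzv [a.succPNat] * mzv [b.succPNat] = ∑ q ∈ antidiagonal (a + b),
      ((q.2.choose a + q.2.choose b : ℕ) : ℝ) * mzv [q.1.succPNat, q.2.succPNat] := by
  have h := ezeta_mul_ezeta a b
  have h1 : ∀ q ∈ antidiagonal (a + b),
      ((q.2.choose a + q.2.choose b : ℕ) : ENNReal) * edzeta q.1 q.2 =
      ENNReal.ofReal (((q.2.choose a + q.2.choose b : ℕ) : ℝ) *
        mzv [q.1.succPNat, q.2.succPNat]) := by
    intro q _
    -- For last entry 1 the double series diverges, but both binomial coefficients vanish because a,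
    -- b ≥ 1, and 0 · ∞ = 0.
    rcases Nat.eq_zero_or_pos q.2 with h0 | h0
    · rw [h0, Nat.choose_eq_zero_of_lt ha, Nat.choose_eq_zero_of_lt hb]; simp
    · rw [edzeta_eq q.1 h0, ENNReal.ofReal_mul (by positivity), ENNReal.ofReal_natCast]
  have hnn : ∀ q : ℕ × ℕ, 0 ≤ ((q.2.choose a + q.2.choose b : ℕ) : ℝ) *
        mzv [q.1.succPNat, q.2.succPNat] := fun q => mul_nonneg (by positivity) (mzv_nonneg _)
  rw [Finset.sum_congr rfl h1, ezeta_eq ha, ezeta_eq hb, ← ENNReal.ofReal_mul (mzv_nonneg _),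
    ← ENNReal.ofReal_sum_of_nonneg fun q _ => hnn q, ENNReal.ofReal_eq_ofReal_iff
      (mul_nonneg (mzv_nonneg _) (mzv_nonneg _)) (Finset.sum_nonneg fun q _ => hnn q)] at h
  exact h

/-! ### The double shuffle relations in odd weight -/

theorem pow_mul_add_pow {S : Type*} [CommSemiring S] (u v : S) (i j : ℕ) :
    v ^ i * (u + v) ^ j = ∑ q ∈ antidiagonal (i + j),
      (j.choose q.1 : S) * (u ^ q.1 * v ^ q.2) := by
  induction i with
  | zero =>
    rw [pow_zero, one_mul, (Commute.all u v).add_pow', zero_add]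
    simp only [nsmul_eq_mul]
  | succ i ih =>
    rw [pow_succ', mul_assoc, ih, Finset.mul_sum, Nat.add_right_comm,
      Finset.Nat.sum_antidiagonal_succ', Nat.choose_eq_zero_of_lt (by omega : j < i + j + 1),
      Nat.cast_zero, zero_mul, zero_add]
    exact Finset.sum_congr rfl fun q _ => by ring

/-- `∑_{i+j=d} D i j uⁱ vʲ`. -/
def genPoly {R S : Type*} [CommRing R] [CommRing S] [Algebra R S] (D : ℕ → ℕ → R) (d : ℕ)
    (u v : S) : S :=
  ∑ q ∈ antidiagonal d, algebraMap R S (D q.1 q.2) * (u ^ q.1 * v ^ q.2)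

section
variable {R S : Type*} [CommRing R] [CommRing S] [Algebra R S] {D : ℕ → ℕ → R} {d : ℕ} {z : R}

/-- Symmetrizing makes all coefficients equal to -z, and the geometric sum times u - v telescopes.
-/
theorem genPoly_stuffle (h : ∀ i j, i + j = d → D i j + D j i = -z) (u v : S) :
    (genPoly D d u v + genPoly D d v u) * (u - v) =
      -algebraMap R S z * (u ^ (d + 1) - v ^ (d + 1)) := by
  have e : genPoly D d v u =
      ∑ q ∈ antidiagonal d,
        algebraMap R S (D q.2 q.1) * (u ^ q.1 * v ^ q.2) := by
    rw [genPoly, ← Finset.Nat.sum_antidiagonal_swap]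
    exact Finset.sum_congr rfl fun q _ => by simp [mul_comm (v ^ _)]
  have e2 : genPoly D d u v + genPoly D d v u =
      -algebraMap R S z * ∑ i ∈ Finset.range (d + 1), u ^ i * v ^ (d + 1 - 1 - i) := by
    rw [e, genPoly, ← Finset.sum_add_distrib, Nat.add_sub_cancel,
      ← Finset.Nat.sum_antidiagonal_eq_sum_range_succ (fun i j => u ^ i * v ^ j), Finset.mul_sum]
    refine Finset.sum_congr rfl fun q hq => ?_
    rw [← add_mul, ← map_add, h _ _ (mem_antidiagonal.1 hq), map_neg]
  rw [e2, mul_assoc, geom_sum₂_mul]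

/-- The hypothesis for (a, b) is exactly the vanishing of the coefficient of u^a v^b after expanding
the powers of u + v. -/
theorem genPoly_shuffle (h : ∀ a b, a + b = d →
      ∑ q ∈ antidiagonal d,
        ((q.2.choose a + q.2.choose b : ℕ) : R) * D q.1 q.2 = 0) (u v : S) :
    genPoly D d v (u + v) + genPoly D d u (u + v) = 0 := by
  have e : ∀ q ∈ antidiagonal d,
      algebraMap R S (D q.1 q.2) * (v ^ q.1 * (u + v) ^ q.2) +
        algebraMap R S (D q.1 q.2) * (u ^ q.1 * (u + v) ^ q.2) =
      ∑ c ∈ antidiagonal d,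
        algebraMap R S (((q.2.choose c.1 + q.2.choose c.2 : ℕ) : R) * D q.1 q.2) *
          (u ^ c.1 * v ^ c.2) := by
    intro q hq
    have hq' := mem_antidiagonal.1 hq
    rw [pow_mul_add_pow, add_comm u v, pow_mul_add_pow, hq',
      ← Finset.Nat.sum_antidiagonal_swap (f := fun c => (q.2.choose c.1 : S) * (v ^ c.1 * u ^ c.2)),
      Finset.mul_sum, Finset.mul_sum, ← Finset.sum_add_distrib]
    refine Finset.sum_congr rfl fun c _ => ?_
    rw [map_mul, map_natCast]
    push_cast
    simp only [Prod.fst_swap, Prod.snd_swap]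
    ring
  rw [genPoly, genPoly, ← Finset.sum_add_distrib, Finset.sum_congr rfl e, Finset.sum_comm]
  refine Finset.sum_eq_zero fun c hc => ?_
  rw [← Finset.sum_mul, ← map_sum, h _ _ (mem_antidiagonal.1 hc), map_zero,
    zero_mul]

theorem genPoly_neg (hd : Odd d) (u v : S) : genPoly D d (-u) (-v) = -genPoly D d u v := by
  rw [genPoly, genPoly, ← Finset.sum_neg_distrib]
  refine Finset.sum_congr rfl fun q hq => ?_
  have hq' := mem_antidiagonal.1 hq
  rw [neg_pow u, neg_pow v]
  have : (-1 : S) ^ q.1 * (-1) ^ q.2 = -1 := by rw [← pow_add, hq', hd.neg_one_pow]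
  linear_combination (algebraMap R S (D q.1 q.2) * (u ^ q.1 * v ^ q.2)) * this

/-- Write F for the generating polynomial. Three shuffle relations and oddness of F express F(u,v) -
F(v,u) as minus two symmetrized terms, at (v, v-u) and (-u, v-u). The stuffle relation evaluates
both; multiplying by u v clears the denominators. -/
theorem genPoly_sub_swap (hd : Odd d) (hst : ∀ i j, i + j = d → D i j + D j i = -z)
    (hsh : ∀ a b, a + b = d → ∑ q ∈ antidiagonal d,
        ((q.2.choose a + q.2.choose b : ℕ) : R) * D q.1 q.2 = 0) (u v : S) :
    u * (v * (genPoly D d u v - genPoly D d v u)) =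
      algebraMap R S z * (v ^ (d + 2) - u ^ (d + 2) - (v + -u) ^ (d + 2)) := by
  have s1 := genPoly_shuffle (S := S) hsh u (v - u)
  have s2 := genPoly_shuffle (S := S) hsh (-v) (v - u)
  rw [show u + (v - u) = v by ring] at s1
  rw [show -v + (v - u) = -u by ring, genPoly_neg hd] at s2
  have t1 := genPoly_stuffle (S := S) hst v (v - u)
  have t2 := genPoly_stuffle (S := S) hst (-u) (v - u)
  have s3 := genPoly_shuffle (S := S) hsh (-u) v
  rw [show -u + v = v - u by ring] at s3
  rw [hd.add_one.neg_pow] at t2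
  linear_combination (u * v) * (s1 + s2 + s3) + u * t2 - v * t1

/-- The solution of the double shuffle relations in odd weight. -/
theorem sub_swap_of_double_shuffle (hd : Odd d) (hst : ∀ i j, i + j = d → D i j + D j i = -z)
    (hsh : ∀ a b, a + b = d → ∑ q ∈ antidiagonal d,
        ((q.2.choose a + q.2.choose b : ℕ) : R) * D q.1 q.2 = 0) {a b : ℕ} (hab : a + b = d) :
    D a b - D b a = (-1) ^ (b + 1) * ((d + 2).choose (a + 1) : R) * z := by
  -- The variable u is the inner polynomial variable and v the outer one; the identity is then read
  -- off at u^(a+1) v^(b+1).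
  have h := genPoly_sub_swap (S := Polynomial (Polynomial R)) hd hst hsh
    (Polynomial.C Polynomial.X) Polynomial.X
  have h1 := congrArg (fun P : Polynomial (Polynomial R) => (P.coeff (b + 1)).coeff (a + 1)) h
  have hF : ∀ i j, i + j = d → ((genPoly D d (Polynomial.C Polynomial.X : Polynomial (Polynomial R))
      Polynomial.X).coeff j).coeff i = D i j := by
    intro i j hij
    have e : ∀ q : ℕ × ℕ, algebraMap R (Polynomial (Polynomial R)) (D q.1 q.2) *
        (Polynomial.C Polynomial.X ^ q.1 * Polynomial.X ^ q.2) =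
        Polynomial.C (Polynomial.C (D q.1 q.2) * Polynomial.X ^ q.1) * Polynomial.X ^ q.2 := by
      intro q
      rw [map_mul, map_pow, mul_assoc]; rfl
    simp only [genPoly, e]
    rw [Polynomial.finsetSum_coeff, Polynomial.finsetSum_coeff, Finset.sum_eq_single (i, j)]
    · rw [Polynomial.coeff_C_mul_X_pow, if_pos rfl, Polynomial.coeff_C_mul_X_pow, if_pos rfl]
    · rintro ⟨i', j'⟩ hq hne
      have hq' := mem_antidiagonal.1 hq
      have : j ≠ j' := fun h => hne (Prod.ext (show i' = i by dsimp only at hq'; omega) h.symm)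
      rw [Polynomial.coeff_C_mul_X_pow, if_neg this, Polynomial.coeff_zero]
    · exact fun h => absurd (mem_antidiagonal.2 hij) h
  have hF' : ((genPoly D d Polynomial.X (Polynomial.C Polynomial.X :
      Polynomial (Polynomial R))).coeff b).coeff a = D b a := by
    have e : ∀ q : ℕ × ℕ, algebraMap R (Polynomial (Polynomial R)) (D q.1 q.2) *
        (Polynomial.X ^ q.1 * Polynomial.C Polynomial.X ^ q.2) =
        Polynomial.C (Polynomial.C (D q.1 q.2) * Polynomial.X ^ q.2) * Polynomial.X ^ q.1 := by
      intro q
      rw [map_mul, map_pow, mul_comm (Polynomial.X ^ q.1), mul_assoc]; rfl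
    simp only [genPoly, e]
    rw [Polynomial.finsetSum_coeff, Polynomial.finsetSum_coeff, Finset.sum_eq_single (b, a)]
    · rw [Polynomial.coeff_C_mul_X_pow, if_pos rfl, Polynomial.coeff_C_mul_X_pow, if_pos rfl]
    · rintro ⟨i', j'⟩ hq hne
      have hq' := mem_antidiagonal.1 hq
      have : b ≠ i' := fun h => hne (Prod.ext h.symm (show j' = a by dsimp only at hq'; omega))
      rw [Polynomial.coeff_C_mul_X_pow, if_neg this, Polynomial.coeff_zero]
    · exact fun h => absurd (mem_antidiagonal.2 (by omega)) h
  have hz : algebraMap R (Polynomial (Polynomial R)) z = Polynomial.C (Polynomial.C z) := rfl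
  -- The pure powers of u and v do not reach the mixed monomial, so only (v - u)^(d+2) contributes.
  have hX : ((Polynomial.X : Polynomial (Polynomial R)) ^ (d + 2) -
      Polynomial.C (Polynomial.X ^ (d + 2))).coeff (b + 1) = 0 := by
    rw [Polynomial.coeff_sub, Polynomial.coeff_X_pow, if_neg (by omega), Polynomial.coeff_C_succ,
      sub_zero]
  have hs : (-1 : R) ^ (b + 1) * (-1) ^ (a + 1) = -1 := by
    rw [← pow_add, show b + 1 + (a + 1) = d + 2 by omega, (hd.add_even even_two).neg_one_pow]
  have hs2 : (-1 : R) ^ (a + 1) * (-1) ^ (a + 1) = 1 := by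
    rw [← mul_pow]; simp
  rw [Polynomial.coeff_C_mul, Polynomial.coeff_X_mul, Polynomial.coeff_X_mul, Polynomial.coeff_sub,
    Polynomial.coeff_sub, hF a b hab, hF', hz, Polynomial.coeff_C_mul, Polynomial.coeff_C_mul,
    Polynomial.coeff_sub, ← Polynomial.C_pow, ← Polynomial.C_neg, hX,
    Polynomial.coeff_X_add_C_pow, zero_sub, Polynomial.coeff_neg,
    show d + 2 - (b + 1) = a + 1 by omega, neg_pow, ← Polynomial.C_1, ← Polynomial.C_neg,
    ← Polynomial.C_pow, mul_assoc, Polynomial.coeff_C_mul, Polynomial.coeff_mul_natCast,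
    Polynomial.coeff_X_pow_self, one_mul] at h1
  rw [h1, ← Nat.choose_symm_of_eq_add (by omega : d + 2 = (b + 1) + (a + 1))]
  linear_combination (z * ((d + 2).choose (b + 1) : R) * (-1) ^ (b + 1)) * hs2 -
    z * (-1) ^ (a + 1) * ((d + 2).choose (b + 1) : R) * hs

end

/-! ### Symmetric sums -/

/-- The symmetric sum `∑ᵢ (-1)^{k_{i+1} + ⋯ + k_r} S(k₁, …, kᵢ) S(k_r, …, k_{i+1})`. -/
def symSum {R : Type*} [CommRing R] (S : Index → R) (k : Index) : R :=
  ∑ i ∈ Finset.range (k.length + 1),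
    (-1) ^ (((k.drop i).map fun a : ℕ+ => (a : ℕ)).sum) * S (k.take i) * S (k.drop i).reverse

section
variable {R : Type*} [CommRing R] {S : Index → R}

/-- In odd weight one of a, b is even, so the product S(a) S(b) is zero and the stuffle product
becomes linear. -/
theorem add_swap_of_stuffle (hmul : ∀ u v, S u * S v = ((stuffle u v).map S).sum)
    (hev : ∀ a : ℕ+, Even (a : ℕ) → S [a] = 0) {a b : ℕ+} (h : Odd ((a : ℕ) + b)) :
    S [a] * S [b] = 0 ∧ S [a, b] + S [b, a] = -S [a + b] := by
  have h0 : S [a] * S [b] = 0 := by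
    rcases Nat.even_or_odd (a : ℕ) with ha | ha
    · rw [hev a ha, zero_mul]
    · rw [hev b ((Nat.odd_add.1 h).1 ha), mul_zero]
  have := hmul [a] [b]
  simp only [stuffle, List.map_cons, List.map_nil, List.nil_append,
    List.cons_append, List.sum_cons, List.sum_nil, h0] at this
  exact ⟨h0, by linear_combination -this⟩

theorem neg_one_pow_eq_of_odd_add {m n : ℕ} (h : Odd (m + n)) : (-1 : R) ^ m = -(-1) ^ n := by
  have h1 : (-1 : R) ^ m * (-1) ^ n = -1 := by rw [← pow_add, h.neg_one_pow]
  have h2 : (-1 : R) ^ n * (-1) ^ n = 1 := by rw [← mul_pow]; simp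
  linear_combination (-1) ^ n * h1 - (-1) ^ m * h2

theorem symSum_singleton (hnil : S [] = 1) {a : ℕ+} (h : Odd (a : ℕ)) : symSum S [a] = 0 := by
  simp only [symSum, Finset.sum_range_succ, Finset.sum_range_zero, List.length_cons,
    List.length_nil, List.drop_zero, List.drop_succ_cons, List.drop_nil, List.take_zero,
    List.take_succ_cons, List.take_nil, List.map_cons, List.map_nil, List.sum_cons, List.sum_nil,
    List.reverse_cons, List.reverse_nil, List.nil_append, hnil, pow_zero,
    add_zero, h.neg_one_pow]
  ring

theorem symSum_pair
    (hnil : S [] = 1) (hmul : ∀ u v, S u * S v = ((stuffle u v).map S).sum)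
    (hev : ∀ a : ℕ+, Even (a : ℕ) → S [a] = 0)
    (hsw : ∀ a b : ℕ+, Odd ((a : ℕ) + b) → S [a, b] - S [b, a] =
      (-1) ^ (b : ℕ) * (((a : ℕ) + b).choose a : R) * S [a + b])
    {a b : ℕ+} (h : Odd ((a : ℕ) + b)) :
    symSum S [a, b] = (-1) ^ (b : ℕ) * (((a : ℕ) + b).choose a : R) * S [a + b] := by
  rw [← hsw _ _ h]
  simp only [symSum, Finset.sum_range_succ, Finset.sum_range_zero, List.length_cons,
    List.length_nil, List.drop_zero, List.drop_succ_cons, List.drop_nil, List.take_zero,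
    List.take_succ_cons, List.take_nil, List.map_cons, List.map_nil, List.sum_cons, List.sum_nil,
    List.reverse_cons, List.reverse_nil, List.nil_append, List.cons_append, hnil, pow_zero,
    add_zero, h.neg_one_pow]
  linear_combination (-1) ^ (b : ℕ) * (add_swap_of_stuffle hmul hev h).1

/-- After the antipode relation, 2 S(c+b,a) and 2 S(c,b+a) are each a sum plus a difference of
swapped pairs, known from `add_swap_of_stuffle` and `hsw`. The two copies of -S(a+b+c) so produced
cancel the depth-one term. -/
theorem two_mul_symSum_triple
    (hnil : S [] = 1) (hmul : ∀ u v, S u * S v = ((stuffle u v).map S).sum)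
    (hev : ∀ a : ℕ+, Even (a : ℕ) → S [a] = 0)
    (hsw : ∀ a b : ℕ+, Odd ((a : ℕ) + b) → S [a, b] - S [b, a] =
      (-1) ^ (b : ℕ) * (((a : ℕ) + b).choose a : R) * S [a + b])
    {a b c : ℕ+} (h : Odd ((a : ℕ) + b + c)) :
    2 * symSum S [a, b, c] = ((-1) ^ (a : ℕ) * (((a : ℕ) + b + c).choose a : R) -
      (-1) ^ (c : ℕ) * (((a : ℕ) + b + c).choose c : R)) * S [a + b + c] := by
  -- Either the value is zero (even entry) or the sign is determined by parity; this and `ha` fit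
  -- the signs of the symmetric sum to those of the antipode relation.
  have hc : (1 + (-1) ^ (c : ℕ)) * S [c] = 0 := by
    rcases Nat.even_or_odd (c : ℕ) with hc | hc
    · rw [hev _ hc, mul_zero]
    · rw [hc.neg_one_pow]; ring
  have ha : ((-1) ^ ((b : ℕ) + c) - 1) * S [a] = 0 := by
    rcases Nat.even_or_odd (a : ℕ) with ha | ha
    · rw [hev _ ha, mul_zero]
    · rw [((Nat.odd_add.1 (add_assoc (a : ℕ) b c ▸ h)).1 ha).neg_one_pow]; ring
  have hodd1 : Odd (((c + b : ℕ+) : ℕ) + a) := by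
    rw [PNat.add_coe, show (c : ℕ) + b + a = a + b + c by ring]; exact h
  have hodd2 : Odd ((c : ℕ) + (b + a : ℕ+)) := by
    rw [PNat.add_coe, show (c : ℕ) + (b + a) = a + b + c by ring]; exact h
  have hac : S [a] * S [c + b] = 0 := (add_swap_of_stuffle hmul hev (by rw [add_comm]; exact hodd1)).1
  have e1 := (add_swap_of_stuffle hmul hev hodd1).2
  have e2 := hsw _ _ hodd1
  have e3 := (add_swap_of_stuffle hmul hev hodd2).2
  have e4 := hsw _ _ hodd2
  have hK1 : c + b + a = a + b + c := by rw [add_comm, add_comm c b, add_assoc]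
  have hK2 : c + (b + a) = a + b + c := by rw [← add_assoc, hK1]
  have hN1 : ((c + b : ℕ+) : ℕ) + a = a + b + c := by rw [PNat.add_coe]; ring
  have hN2 : (c : ℕ) + (b + a : ℕ+) = a + b + c := by rw [PNat.add_coe]; ring
  rw [hN1, hK1, Nat.choose_symm_of_eq_add (by rw [PNat.add_coe]; ring :
    (a : ℕ) + b + c = (c + b : ℕ+) + a)] at e2
  rw [hN2, hK2] at e4
  rw [hK1] at e1
  rw [hK2] at e3
  have hs : (-1 : R) ^ ((b + a : ℕ+) : ℕ) = -(-1) ^ (c : ℕ) :=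
    neg_one_pow_eq_of_odd_add (by rw [add_comm]; exact hodd2)
  rw [hs] at e4
  have anti := antipode_of_stuffle S hmul a b c
  have hS : symSum S [a, b, c] = -S [c, b, a] +
      (-1) ^ ((b : ℕ) + c) * S [a] * S [c, b] +
      (-1) ^ (c : ℕ) * S [a, b] * S [c] + S [a, b, c] := by
    simp only [symSum, Finset.sum_range_succ, Finset.sum_range_zero, List.length_cons,
      List.length_nil, List.drop_zero, List.drop_succ_cons, List.drop_nil, List.take_zero,
      List.take_succ_cons, List.take_nil, List.map_cons, List.map_nil, List.sum_cons, List.sum_nil,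
      List.reverse_cons, List.reverse_nil, List.nil_append, List.cons_append, hnil, pow_zero,
      add_zero, ← add_assoc, h.neg_one_pow]
    ring
  rw [hS]
  linear_combination 2 * anti + 2 * S [a, b] * hc + 2 * S [c, b] * ha - 2 * hac +
    e1 + e2 + e3 + e4

/-- The contractions (a,b+c) and (a+b,c) contribute the two binomial terms of the depth-three
formula with opposite signs, and (a+b+c) contributes zero. -/
theorem symSum_triple_star
    (hnil : S [] = 1) (hmul : ∀ u v, S u * S v = ((stuffle u v).map S).sum)
    (hev : ∀ a : ℕ+, Even (a : ℕ) → S [a] = 0)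
    (hsw : ∀ a b : ℕ+, Odd ((a : ℕ) + b) → S [a, b] - S [b, a] =
      (-1) ^ (b : ℕ) * (((a : ℕ) + b).choose a : R) * S [a + b])
    {a b c : ℕ+} (h : Odd ((a : ℕ) + b + c)) :
    symSum S [a, b, c] + ((contractions [a, b, c]).map (symSum S)).sum = 0 := by
  have hodd1 : Odd ((a : ℕ) + (b + c : ℕ+)) := by rw [PNat.add_coe, ← add_assoc]; exact h
  have hodd2 : Odd (((a + b : ℕ+) : ℕ) + c) := by rw [PNat.add_coe]; exact h
  have hodd3 : Odd ((a + b + c : ℕ+) : ℕ) := by rw [PNat.add_coe, PNat.add_coe]; exact h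
  have e1 := symSum_pair hnil hmul hev hsw hodd1
  have e2 := symSum_pair hnil hmul hev hsw hodd2
  have e3 := symSum_singleton hnil hodd3
  have e4 := two_mul_symSum_triple hnil hmul hev hsw h
  rw [← add_assoc, PNat.add_coe, ← add_assoc] at e1
  rw [PNat.add_coe, Nat.choose_symm_add] at e2
  have hs : (-1 : R) ^ ((b : ℕ) + c) = -(-1) ^ (a : ℕ) :=
    neg_one_pow_eq_of_odd_add (by rw [add_comm, ← add_assoc]; exact h)
  rw [hs] at e1
  simp only [contractions, List.map_cons, List.map_nil, List.cons_append, List.nil_append,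
    List.sum_cons, List.sum_nil, e3]
  linear_combination e1 + e2 + e4

theorem eq_half_smul [Module ℚ R] {x y : R} (n : ℤ) (h : 2 * x = n * y) :
    x = ((1 / 2 : ℚ) * n) • y := by
  rw [mul_smul, Int.cast_smul_eq_zsmul, zsmul_eq_mul, ← h, two_mul, ← two_smul ℚ x, smul_smul]
  norm_num

end

/-! ### Harmonic regularized values modulo `ζ(2)` -/

/-- `ζ^*(k)` modulo `ζ(2)`. -/
noncomputable def zetaBar (k : Index) : ZBar := Ideal.Quotient.mk (Ideal.span {zeta2}) (zetaHarm k)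

theorem zetaBar_mul (u v : Index) : zetaBar u * zetaBar v = ((stuffle u v).map zetaBar).sum := by
  unfold zetaBar
  rw [← map_mul, zetaHarm_mul, map_list_sum, List.map_map]; rfl

theorem hasSum_mzv_singleton {b : ℕ+} (hb : 2 ≤ b) : HasSum (invPow b) (mzv [b]) := by
  have h := (hasSum_mzv_append_singleton [] hb).2.1
  have e : ∀ n, mhs n [] = 1 := fun n => rfl
  simpa only [e, mul_one, List.nil_append] using h

theorem mzv_two : mzv [2] = Real.pi ^ 2 / 6 := by
  refine (hasSum_mzv_singleton le_rfl).unique ?_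
  convert hasSum_zeta_two using 2 with n
  simp [invPow]

theorem admissible_singleton {a : ℕ+} (ha : 2 ≤ a) : Admissible [a] := by
  simpa [Admissible] using ha

theorem admissible_pair (a : ℕ+) {b : ℕ+} (hb : 2 ≤ b) : Admissible [a, b] := by
  simpa [Admissible] using hb

/-- By Euler, ζ(2m) is a rational multiple of π^(2m), hence of ζ(2)^m; as m ≥ 1, a factor ζ(2) can
be split off inside 𝒵. -/
theorem zetaBar_even {k : ℕ+} (hk : Even (k : ℕ)) : zetaBar [k] = 0 := by
  obtain ⟨m, hm⟩ := hk
  have hm0 : m ≠ 0 := fun h => by have := k.pos; omega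
  have hk2 : 2 ≤ k := by rw [← PNat.coe_le_coe]; change 2 ≤ (k : ℕ); omega
  obtain ⟨r, hr⟩ : ∃ r : ℚ, mzv [k] = r • (mzv [2]) ^ m := by
    -- Euler's coefficient times 6^m, because π² = 6 ζ(2).
    refine ⟨(-1) ^ (m + 1) * 2 ^ (2 * m - 1) * 6 ^ m * bernoulli (2 * m) / (2 * m).factorial, ?_⟩
    refine (hasSum_mzv_singleton hk2).unique ?_
    convert hasSum_zeta_nat hm0 using 1
    · funext n
      rw [invPow, hm, one_div, two_mul]
    · rw [mzv_two, Rat.smul_def, div_pow, pow_mul]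
      push_cast
      field_simp
  have h : zetaHarm [k] = zeta2 * (r • zeta2 ^ (m - 1)) := by
    rw [zetaHarm_admissible (admissible_singleton hk2), mul_smul_comm, ← pow_succ',
      Nat.sub_add_cancel (Nat.pos_of_ne_zero hm0)]
    refine Subtype.ext ?_
    exact hr
  unfold zetaBar
  rw [h, map_mul, Ideal.Quotient.eq_zero_iff_mem.2 (Ideal.mem_span_singleton_self zeta2), zero_mul]

theorem zetaBar_mul_odd {a b : ℕ+} (h : Odd ((a : ℕ) + b)) : zetaBar [a] * zetaBar [b] = 0 :=
  (add_swap_of_stuffle zetaBar_mul (fun _ => zetaBar_even) h).1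

theorem zetaBar_add_swap {a b : ℕ+} (h : Odd ((a : ℕ) + b)) :
    zetaBar [a, b] + zetaBar [b, a] = -zetaBar [a + b] :=
  (add_swap_of_stuffle zetaBar_mul (fun _ => zetaBar_even) h).2

theorem zetaBar_shuffle_of_pos {a b : ℕ} (ha : 1 ≤ a) (hb : 1 ≤ b) (hd : Odd (a + b)) :
    ∑ q ∈ antidiagonal (a + b),
      ((q.2.choose a + q.2.choose b : ℕ) : ZBar) * zetaBar [q.1.succPNat, q.2.succPNat] = 0 := by
  have h1 : ∀ q ∈ antidiagonal (a + b),
      (((q.2.choose a + q.2.choose b : ℕ) : MZVAlg) * zetaHarm [q.1.succPNat, q.2.succPNat] :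
        MZVAlg).1 =
      ((q.2.choose a + q.2.choose b : ℕ) : ℝ) * mzv [q.1.succPNat, q.2.succPNat] := by
    intro q _
    rcases Nat.eq_zero_or_pos q.2 with h0 | h0
    -- Here the regularized value need not equal `mzv`, but its coefficient is zero.
    · rw [h0, Nat.choose_eq_zero_of_lt ha, Nat.choose_eq_zero_of_lt hb]; simp
    · rw [zetaHarm_admissible (admissible_pair _ (two_le_succPNat h0))]; rfl
  have h2 : zetaHarm [a.succPNat] * zetaHarm [b.succPNat] =
      ∑ q ∈ antidiagonal (a + b),
      ((q.2.choose a + q.2.choose b : ℕ) : MZVAlg) * zetaHarm [q.1.succPNat, q.2.succPNat] := by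
    refine Subtype.ext ?_
    rw [zetaHarm_admissible (admissible_singleton (two_le_succPNat ha)),
      zetaHarm_admissible (admissible_singleton (two_le_succPNat hb)),
      AddSubmonoidClass.coe_finsetSum, Finset.sum_congr rfl h1]
    exact mzv_mul_mzv ha hb
  have h3 := zetaBar_mul_odd (a := a.succPNat) (b := b.succPNat) (by
    rw [Nat.succPNat_coe, Nat.succPNat_coe, show a.succ + b.succ = a + b + 2 by omega]
    exact hd.add_even even_two)
  unfold zetaBar at h3 ⊢
  rw [← map_mul, h2, map_sum] at h3
  simpa only [map_mul, map_natCast] using h3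

/-- This relation replaces the divergent product ζ(1) ζ(d+1). The admissible terms add up to ζ(d+2)
by the sum formula, and ζ^*(d+1,1) + ζ(1,d+1) equals -ζ(d+2) by the stuffle product. -/
theorem zetaBar_shuffle_zero {d : ℕ} (hd : Odd d) :
    ∑ q ∈ antidiagonal d,
      ((q.2.choose 0 + q.2.choose d : ℕ) : ZBar) * zetaBar [q.1.succPNat, q.2.succPNat] = 0 := by
  obtain ⟨e, rfl⟩ : ∃ e, d = e + 1 := ⟨d - 1, (Nat.succ_pred_eq_of_pos hd.pos).symm⟩
  have h2 : ∑ q ∈ antidiagonal e,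
      zetaHarm [q.1.succPNat, (q.2 + 1).succPNat] = zetaHarm [(e + 2).succPNat] := by
    refine Subtype.ext ?_
    rw [zetaHarm_admissible (admissible_singleton (two_le_succPNat (by omega))),
      AddSubmonoidClass.coe_finsetSum]
    refine Eq.trans (Finset.sum_congr rfl fun q _ => ?_) (sum_mzv_pair e)
    rw [zetaHarm_admissible (admissible_pair _ (two_le_succPNat (by omega)))]; rfl
  have h3 : ∑ q ∈ antidiagonal e,
      zetaBar [q.1.succPNat, (q.2 + 1).succPNat] = zetaBar [(e + 2).succPNat] := by
    unfold zetaBar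
    rw [← h2, map_sum]
  have h4 := zetaBar_add_swap (a := 1) (b := (e + 1).succPNat) (by
    rw [Nat.succPNat_coe, PNat.one_coe, Nat.succ_eq_add_one, add_comm]; exact hd.add_one.add_one)
  rw [show 1 + (e + 1).succPNat = (e + 2).succPNat from PNat.eq (by simp; omega)] at h4
  have h5 : ∑ q ∈ antidiagonal (e + 1),
      (q.2.choose (e + 1) : ZBar) * zetaBar [q.1.succPNat, q.2.succPNat] =
      zetaBar [1, (e + 1).succPNat] := by
    rw [Finset.sum_eq_single (0, e + 1)]
    · simp; rfl
    · rintro ⟨i, j⟩ hq hne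
      have hq' := mem_antidiagonal.1 hq
      have : j < e + 1 := by
        by_contra hj
        exact hne (Prod.ext (show i = 0 by dsimp only at hq'; omega)
          (show j = e + 1 by dsimp only at hq'; omega))
      simp [Nat.choose_eq_zero_of_lt this]
    · intro h; exact absurd (mem_antidiagonal.2 (by simp)) h
  simp only [Nat.cast_add, add_mul, Finset.sum_add_distrib, Nat.choose_zero_right, Nat.cast_one,
    one_mul]
  rw [h5, Finset.Nat.sum_antidiagonal_succ', h3, show Nat.succPNat 0 = 1 from rfl]
  linear_combination h4

theorem zetaBar_sub_swap {a b : ℕ+} (h : Odd ((a : ℕ) + b)) :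
    zetaBar [a, b] - zetaBar [b, a] =
      (-1) ^ (b : ℕ) * (((a : ℕ) + b).choose a : ZBar) * zetaBar [a + b] := by
  obtain ⟨i, rfl⟩ : ∃ i, a = Nat.succPNat i := ⟨_, (PNat.succPNat_natPred a).symm⟩
  obtain ⟨j, rfl⟩ : ∃ j, b = Nat.succPNat j := ⟨_, (PNat.succPNat_natPred b).symm⟩
  have hd : Odd (i + j) := by
    rw [Nat.succPNat_coe, Nat.succPNat_coe, show i.succ + j.succ = i + j + 2 by omega] at h
    exact (Nat.odd_add.1 h).2 even_two
  have key := sub_swap_of_double_shuffle (R := ZBar)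
    (D := fun i j => zetaBar [i.succPNat, j.succPNat]) (z := zetaBar [i.succPNat + j.succPNat]) hd
    (fun m n hmn => by
      rw [zetaBar_add_swap]
      · congr 3
        exact PNat.eq (by simp; omega)
      · simp only [Nat.succPNat_coe]
        rw [show m.succ + n.succ = i + j + 2 by omega]
        exact hd.add_even even_two)
    (fun m n hmn => by
      rcases Nat.eq_zero_or_pos m with rfl | hm
      · rw [zero_add] at hmn; subst hmn; exact zetaBar_shuffle_zero hd
      rcases Nat.eq_zero_or_pos n with rfl | hn
      · rw [add_zero] at hmn; subst hmn
        simp only [add_comm (Nat.choose _ (i + j))]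
        exact zetaBar_shuffle_zero hd
      · rw [← hmn]; exact zetaBar_shuffle_of_pos hm hn (hmn ▸ hd)) (a := i) (b := j) rfl
  simp only [Nat.succPNat_coe]
  rw [show i.succ + j.succ = i + j + 2 by omega]
  exact key

/-! ### Symmetric multiple zeta values -/

theorem constantCoeff_tailSeries (d : Index) :
    PowerSeries.constantCoeff (tailSeries d) = zetaHarm d.reverse := by
  have h : addIndex d 0 = d := by
    unfold addIndex
    conv_rhs => rw [← List.ofFn_get d]
    rfl
  rw [← PowerSeries.coeff_zero_eq_constantCoeff_apply, tailSeries, PowerSeries.coeff_mk,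
    Finset.Nat.antidiagonalTuple_zero_right, Finset.sum_singleton, h]
  simp

theorem constantCoeff_zetaSHat (k : Index) :
    PowerSeries.constantCoeff (zetaSHat k) = symSum zetaBar k := by
  rw [zetaSHat, ← PowerSeries.coeff_zero_eq_constantCoeff_apply, PowerSeries.coeff_map,
    PowerSeries.coeff_zero_eq_constantCoeff_apply, zetaSHatLift, map_sum, map_sum, symSum]
  refine Finset.sum_congr rfl fun i _ => ?_
  rw [map_mul, constantCoeff_tailSeries, PowerSeries.constantCoeff_C, map_mul, map_mul, map_pow,
    map_neg, map_one]
  rfl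

/-- Modulo t only constant terms survive, so the symmetric values reduce to `symSum`. -/
theorem toS_one_eq (f : PowerSeries ZBar) :
    toS 1 f = toS 1 (PowerSeries.C (PowerSeries.constantCoeff f)) := by
  refine Ideal.Quotient.eq.2 (Ideal.mem_span_singleton.2 ?_)
  rw [pow_one, PowerSeries.X_dvd_iff]
  simp

theorem zetaBar_nil : zetaBar [] = 1 := by
  rw [zetaBar, zetaHarm_nil, map_one]

/-- The case `𝓕 = 𝓢` of the theorem. -/
theorem zetaS_one_triple {a b c : ℕ+} (h : Odd ((a + b + c : ℕ+) : ℕ)) :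
    zetaS 1 [a, b, c] = -zetaSStar 1 [a, b, c] ∧
      -zetaSStar 1 [a, b, c] =
        ((1 / 2 : ℚ) * ((-1) ^ (a : ℕ) * (((a + b + c : ℕ+) : ℕ).choose a : ℚ) -
          (-1) ^ (c : ℕ) * (((a + b + c : ℕ+) : ℕ).choose c : ℚ))) • frakZS 1 (a + b + c) := by
  have hK : 2 ≤ a + b + c := by
    rw [← PNat.coe_le_coe]
    have := a.pos; have := b.pos; have := c.pos
    simp only [PNat.add_coe, PNat.val_ofNat]; omega
  have hz : Ideal.Quotient.mk (Ideal.span {zeta2}) (Zmap (word [a + b + c])) =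
      zetaBar [a + b + c] := by
    rw [zetaBar, Zmap_word (admissible_singleton hK), zetaHarm_admissible (admissible_singleton hK)]
  rw [PNat.add_coe, PNat.add_coe] at h ⊢
  have e1 : zetaS 1 [a, b, c] = toS 1 (PowerSeries.C (symSum zetaBar [a, b, c])) := by
    rw [zetaS, toS_one_eq, constantCoeff_zetaSHat]
  have e2 : zetaSStar 1 [a, b, c] =
      toS 1 (PowerSeries.C ((contractions [a, b, c]).map (symSum zetaBar)).sum) := by
    rw [zetaSStar, toS_one_eq, zetaSHatStar, map_list_sum, List.map_map]
    congr 4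
    funext k
    exact constantCoeff_zetaSHat k
  have e3 : zetaS 1 [a, b, c] = -zetaSStar 1 [a, b, c] := by
    rw [eq_neg_iff_add_eq_zero, e1, e2, ← map_add, ← map_add, symSum_triple_star zetaBar_nil zetaBar_mul (fun _ => zetaBar_even)
      (fun _ _ => zetaBar_sub_swap) h, map_zero,
      map_zero]
  refine ⟨e3, ?_⟩
  rw [← e3, e1, frakZS, hz]
  -- A ring homomorphism between ℚ-algebras is automatically ℚ-linear.
  have hsm : ∀ (q : ℚ) (x : ZBar), q • toS 1 (PowerSeries.C x) = toS 1 (PowerSeries.C (q • x)) :=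
    fun q x => (map_rat_smul ((toS 1).comp PowerSeries.C) q x).symm
  rw [hsm]
  congr 2
  have h2 := eq_half_smul (x := symSum zetaBar [a, b, c]) (y := zetaBar [a + b + c])
    ((-1) ^ (a : ℕ) * (((a : ℕ) + b + c).choose a : ℤ) -
      (-1) ^ (c : ℕ) * (((a : ℕ) + b + c).choose c : ℤ)) (by
      rw [two_mul_symSum_triple zetaBar_nil zetaBar_mul (fun _ => zetaBar_even)
        (fun _ _ => zetaBar_sub_swap) h]
      push_cast
      rfl)
  push_cast at h2
  exact h2

/-! ### Star sums -/

/-- The truncated sum `∑_{M < n₁ ≤ ⋯ ≤ nᵣ ≤ N} g k₁ n₁ ⋯ g kᵣ nᵣ`. -/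
def truncStar {R : Type*} [CommSemiring R] (g : ℕ+ → ℕ → R) (N : ℕ) : Index → ℕ → R
  | [], _ => 1
  | a :: u, M => ∑ n ∈ Finset.Ioc M N, g a n * truncStar g N u (n - 1)

section
variable {R : Type*} [CommSemiring R] (g : ℕ+ → ℕ → R) (N : ℕ)

/-- Each weak inequality splits into a strict one (comma) and an equality (plus, since the weights
multiply). -/
theorem truncStar_eq_sum_contractions (hg : ∀ a b n, g (a + b) n = g a n * g b n)
    (k : Index) (M : ℕ) :
    truncStar g N k M = ((contractions k).map (truncSum g N · M)).sum := by
  induction k using contractions.induct generalizing M with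
  | case1 => simp [contractions, truncStar, truncSum]
  | case2 a => simp [contractions, truncStar, truncSum]
  | case3 a b t h1 h2 =>
    rw [contractions, List.map_append, List.sum_append, truncSum_map_cons, ← h2, truncStar,
      truncStar, ← Finset.sum_add_distrib]
    refine Finset.sum_congr rfl fun n hn => ?_
    rw [← h1, truncStar, truncStar, hg]
    have hn' := Finset.mem_Ioc.1 hn
    have e : Finset.Ioc (n - 1) N = insert n (Finset.Ioc n N) := by
      ext m; simp only [Finset.mem_insert, Finset.mem_Ioc]; omega
    rw [e, Finset.sum_insert (by simp)]
    ring

/-- Star sums as sums over weakly increasing tuples. -/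
theorem sum_monotone_eq_truncStar (k : Index) (M : ℕ)
    (inst : DecidablePred fun m : Fin k.length → ℕ => Monotone m) :
    ∑ m ∈ (Fintype.piFinset fun _ : Fin k.length => Finset.Ioc M N).filter
      (fun m => Monotone m), ∏ i, g (k.get i) (m i) = truncStar g N k M := by
  classical
  induction k generalizing M with
  | nil =>
    rw [truncStar]
    have : (Fintype.piFinset fun _ : Fin ([] : Index).length => Finset.Ioc M N).filter
      (fun m => Monotone m) = {fun i => i.elim0} := by
      ext m
      simp only [Finset.mem_filter, Fintype.mem_piFinset, Finset.mem_singleton]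
      exact ⟨fun _ => funext fun i => i.elim0, fun _ => ⟨fun i => i.elim0, fun i => i.elim0⟩⟩
    rw [this, Finset.sum_singleton]
    exact Finset.prod_empty
  | cons a u ih =>
    rw [truncStar]
    have e : ∀ n ∈ Finset.Ioc M N, g a n * truncStar g N u (n - 1) =
        ∑ m ∈ (Fintype.piFinset fun _ : Fin u.length => Finset.Ioc (n - 1) N).filter
          (fun m => Monotone m), g a n * ∏ i, g (u.get i) (m i) := fun n _ => by
      rw [← ih (n - 1) inferInstance, Finset.mul_sum]
    rw [Finset.sum_congr rfl e, Finset.sum_sigma']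
    refine Finset.sum_bij' (fun m _ => ⟨m (0 : Fin (u.length + 1)), Fin.tail m⟩)
      (fun s _ => (Fin.cons s.1 s.2 : Fin (u.length + 1) → ℕ)) ?_ ?_ ?_ ?_ ?_
    · intro m hm
      simp only [Finset.mem_filter, Fintype.mem_piFinset, Finset.mem_sigma, Finset.mem_Ioc] at hm ⊢
      obtain ⟨h1, h2⟩ := hm
      refine ⟨h1 (0 : Fin (u.length + 1)), fun i => ⟨?_, (h1 (Fin.succ i)).2⟩,
        fun i j hij => h2 (Fin.succ_le_succ_iff.2 hij)⟩
      have h3 : m (0 : Fin (u.length + 1)) ≤ m (Fin.succ i) := h2 (Fin.zero_le _)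
      have h4 := (h1 (0 : Fin (u.length + 1))).1
      change _ < m (Fin.succ i)
      omega
    · rintro ⟨n, m⟩ hm
      simp only [Finset.mem_filter, Fintype.mem_piFinset, Finset.mem_sigma, Finset.mem_Ioc] at hm ⊢
      obtain ⟨h0, h1, h2⟩ := hm
      constructor
      · intro i
        refine Fin.cases (motive := fun i : Fin (u.length + 1) =>
          M < (Fin.cons n m : Fin (u.length + 1) → ℕ) i ∧
          (Fin.cons n m : Fin (u.length + 1) → ℕ) i ≤ N) ?_ (fun j => ?_) i
        · simpa using h0
        · rw [Fin.cons_succ]; exact ⟨by have := (h1 j).1; omega, (h1 j).2⟩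
      · intro i j hij
        refine Fin.cases (motive := fun i : Fin (u.length + 1) => ∀ j, i ≤ j →
          (Fin.cons n m : Fin (u.length + 1) → ℕ) i ≤
          (Fin.cons n m : Fin (u.length + 1) → ℕ) j) ?_ (fun i => ?_) i j hij
        · refine Fin.cases ?_ (fun j _ => ?_)
          · intro h; exact le_rfl
          · rw [Fin.cons_zero, Fin.cons_succ]; have := (h1 j).1; omega
        · refine Fin.cases ?_ (fun j hij => ?_)
          · intro h; exact absurd h (by simp)
          · rw [Fin.cons_succ, Fin.cons_succ]; exact h2 (Fin.succ_le_succ_iff.1 hij)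
    · intro m _
      exact Fin.cons_self_tail (n := u.length) (α := fun _ => ℕ) m
    · rintro ⟨n, m⟩ _
      rfl
    · intro m _
      exact Fin.prod_univ_succ (n := u.length) (fun i => g ((a :: u).get i) (m i))

/-- Reversal of truncated sums under `n ↦ q - n`. -/
theorem truncSum_reverse {q : ℕ} (ε : ℕ+ → R)
    (hε : ∀ a n, 0 < n → n < q → g a (q - n) = ε a * g a n) (u : Index) {M N : ℕ}
    (hN : N < q) :
    truncSum g N u.reverse M = (u.map ε).prod * truncSum g (q - 1 - M) u (q - 1 - N) := by
  induction u generalizing N with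
  | nil => simp [truncSum]
  | cons a u ih =>
    rw [List.reverse_cons, truncSum_append_singleton, truncSum, List.map_cons, List.prod_cons,
      Finset.mul_sum]
    refine Finset.sum_bij' (fun n _ => q - n) (fun n _ => q - n) ?_ ?_ ?_ ?_ ?_
    · intro n hn
      simp only [Finset.mem_Ioc] at hn ⊢; omega
    · intro n hn
      simp only [Finset.mem_Ioc] at hn ⊢; omega
    · intro n hn
      simp only [Finset.mem_Ioc] at hn; omega
    · intro n hn
      simp only [Finset.mem_Ioc] at hn; omega
    · intro n hn
      simp only [Finset.mem_Ioc] at hn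
      have e := hε a (q - n) (by omega) (by omega)
      rw [show q - (q - n) = n by omega] at e
      rw [ih (by omega), e, show q - 1 - (n - 1) = q - n by omega]
      ring

end

/-! ### Reduction of rational numbers -/

section
variable {F : Type*} [Field F]

/-- The rational number `x` reduces to `y`. -/
def Reduces (x : ℚ) (y : F) : Prop := (x.den : F) ≠ 0 ∧ (x : F) = y

/-- In characteristic p the cast from ℚ respects sums and products only when denominators stay
nonzero, so denominator and value are carried together. -/
theorem Reduces.add {x x' : ℚ} {y y' : F} (h : Reduces x y) (h' : Reduces x' y') :
    Reduces (x + x') (y + y') := by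
  refine ⟨fun h0 => ?_, by rw [Rat.cast_add_of_ne_zero h.1 h'.1, h.2, h'.2]⟩
  obtain ⟨c, hc⟩ := Rat.add_den_dvd x x'
  have := congrArg (Nat.cast : ℕ → F) hc
  push_cast at this
  rw [h0, zero_mul] at this
  exact mul_ne_zero h.1 h'.1 this

theorem Reduces.mul {x x' : ℚ} {y y' : F} (h : Reduces x y) (h' : Reduces x' y') :
    Reduces (x * x') (y * y') := by
  refine ⟨fun h0 => ?_, by rw [Rat.cast_mul_of_ne_zero h.1 h'.1, h.2, h'.2]⟩
  obtain ⟨c, hc⟩ := Rat.mul_den_dvd x x'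
  have := congrArg (Nat.cast : ℕ → F) hc
  push_cast at this
  rw [h0, zero_mul] at this
  exact mul_ne_zero h.1 h'.1 this

theorem Reduces.natCast (n : ℕ) : Reduces (n : ℚ) (n : F) := ⟨by simp, by simp⟩

theorem Reduces.neg {x : ℚ} {y : F} (h : Reduces x y) : Reduces (-x) (-y) :=
  ⟨by simpa using h.1, by rw [Rat.cast_neg, h.2]⟩

theorem Reduces.div_nat {x : ℚ} {y : F} (h : Reduces x y) {n : ℕ} (hn : (n : F) ≠ 0) :
    Reduces (x / n) (y / n) := by
  rw [div_eq_mul_inv, div_eq_mul_inv]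
  refine h.mul ⟨?_, ?_⟩
  · rw [Rat.inv_natCast_den]
    split_ifs
    · simp
    · exact hn
  · rw [Rat.cast_inv_of_ne_zero (by simpa using hn), Rat.cast_natCast]

theorem Reduces.pow {x : ℚ} {y : F} (h : Reduces x y) (n : ℕ) : Reduces (x ^ n) (y ^ n) := by
  induction n with
  | zero => simpa using Reduces.natCast (F := F) 1
  | succ n ih => rw [pow_succ, pow_succ]; exact ih.mul h

theorem Reduces.sum {ι : Type*} {x : ι → ℚ} {y : ι → F} (s : Finset ι)
    (h : ∀ i ∈ s, Reduces (x i) (y i)) : Reduces (∑ i ∈ s, x i) (∑ i ∈ s, y i) := by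
  classical
  induction s using Finset.induction_on with
  | empty => simpa using Reduces.natCast (F := F) 0
  | insert i s hi ih =>
    rw [Finset.sum_insert hi, Finset.sum_insert hi]
    exact (h i (by simp)).add (ih fun j hj => h j (by simp [hj]))

theorem Reduces.unique {x : ℚ} {y z : F} (h : Reduces x y) (h' : Reduces x z) : y = z :=
  h.2.symm.trans h'.2

/-- Bernoulli numbers of index at most `N` are integral where `1, …, N + 1` are invertible. -/
theorem reduces_bernoulli {N : ℕ} (hN : ∀ n, 0 < n → n ≤ N + 1 → (n : F) ≠ 0) {i : ℕ}
    (hi : i ≤ N) : Reduces (bernoulli i) ((bernoulli i : ℚ) : F) := by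
  induction i using Nat.strong_induction_on with
  | _ i ih =>
    have h := sum_bernoulli (i + 1)
    rw [Finset.sum_range_succ] at h
    have hc : (((i + 1).choose i : ℕ) : ℚ) = ((i + 1 : ℕ) : ℚ) := by
      rw [Nat.choose_succ_self_right]
    rw [hc] at h
    have h1 : ((i + 1 : ℕ) : ℚ) ≠ 0 := by positivity
    -- The Bernoulli recursion solved for its last term; the only new denominator is i + 1.
    have e : bernoulli i = (((if i + 1 = 1 then 1 else 0 : ℕ) : ℚ) +
        -∑ k ∈ Finset.range i, ((i + 1).choose k : ℚ) * bernoulli k) / ((i + 1 : ℕ) : ℚ) := by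
      rw [eq_div_iff h1]
      push_cast at h ⊢
      linear_combination h
    have hs : Reduces (∑ k ∈ Finset.range i, ((i + 1).choose k : ℚ) * bernoulli k)
        (∑ k ∈ Finset.range i, ((i + 1).choose k : F) * ((bernoulli k : ℚ) : F)) :=
      Reduces.sum _ fun k hk => (Reduces.natCast _).mul
        (ih k (Finset.mem_range.1 hk) (by have := Finset.mem_range.1 hk; omega))
    have := ((Reduces.natCast (F := F) (if i + 1 = 1 then 1 else 0)).add hs.neg).div_nat
      (hN (i + 1) (by omega) (by omega))
    rw [← e] at this
    exact ⟨this.1, rfl⟩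

/-- Faulhaber's formula in fields where it makes sense. -/
theorem sum_range_pow_field {e : ℕ} (hN : ∀ n, 0 < n → n ≤ e + 1 → (n : F) ≠ 0) (n : ℕ) :
    ∑ k ∈ Finset.range n, (k : F) ^ e =
      ∑ i ∈ Finset.range (e + 1), ((bernoulli i : ℚ) : F) * ((e + 1).choose i : F) *
        (n : F) ^ (e + 1 - i) / ((e + 1 : ℕ) : F) := by
  -- Both sides of the formula are reductions of the same rational number, so Faulhaber's formula
  -- over ℚ suffices.
  have h1 : Reduces (∑ k ∈ Finset.range n, (k : ℚ) ^ e) (∑ k ∈ Finset.range n, (k : F) ^ e) :=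
    Reduces.sum _ fun k _ => (Reduces.natCast k).pow e
  refine h1.unique ?_
  rw [sum_range_pow]
  refine Reduces.sum _ fun i hi => ?_
  have h2 := (((reduces_bernoulli hN (Nat.lt_succ_iff.1 (Finset.mem_range.1 hi))).mul
    (Reduces.natCast ((e + 1).choose i))).mul ((Reduces.natCast n).pow (e + 1 - i))).div_nat
    (hN (e + 1) (by omega) le_rfl)
  push_cast at h2 ⊢
  exact h2

end

/-! ### Truncated sums modulo a prime -/

/-- The weight `n⁻ᵃ` modulo `q`. -/
def zinv (q : ℕ) (a : ℕ+) (n : ℕ) : ZMod q := ((n : ZMod q) ^ (a : ℕ))⁻¹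

/-- The multiple harmonic sum modulo `q`. -/
def modSum (q : ℕ) (k : Index) : ZMod q := truncSum (zinv q) (q - 1) k 0

section
variable {q : ℕ} [Fact q.Prime]

theorem zinv_add (a b : ℕ+) (n : ℕ) : zinv q (a + b) n = zinv q a n * zinv q b n := by
  rw [zinv, zinv, zinv, ← mul_inv, ← pow_add, PNat.add_coe]

theorem natCast_ne_zero_of_lt {n : ℕ} (h0 : 0 < n) (hn : n < q) : (n : ZMod q) ≠ 0 := by
  rw [Ne, ZMod.natCast_eq_zero_iff]
  exact Nat.not_dvd_of_pos_of_lt h0 hn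

theorem zinv_eq_pow {a : ℕ+} (ha : (a : ℕ) ≤ q - 1) {n : ℕ} (h0 : 0 < n) (hn : n < q) :
    zinv q a n = (n : ZMod q) ^ (q - 1 - a) := by
  have h := natCast_ne_zero_of_lt h0 hn
  refine inv_eq_of_mul_eq_one_right ?_
  rw [← pow_add, Nat.add_sub_cancel' ha, ZMod.pow_card_sub_one_eq_one h]

theorem sum_Ioc_pow_zmod (l : ℕ) :
    ∑ n ∈ Finset.Ioc 0 (q - 1), (n : ZMod q) ^ l = if q - 1 ∣ l then -1 else 0 := by
  have hbij : ∑ n ∈ Finset.Ioc 0 (q - 1), (n : ZMod q) ^ l =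
      ∑ u : (ZMod q)ˣ, (u : ZMod q) ^ l :=
    Finset.sum_bij'
      (fun n hn => Units.mk0 (n : ZMod q) (natCast_ne_zero_of_lt (Finset.mem_Ioc.1 hn).1
        (by have := Finset.mem_Ioc.1 hn; omega)))
      (fun u _ => (u : ZMod q).val)
      (fun _ _ => Finset.mem_univ _)
      (fun u _ => by
        have h1 : (u : ZMod q).val ≠ 0 := (ZMod.val_ne_zero _).2 u.ne_zero
        have h2 := ZMod.val_lt (u : ZMod q)
        rw [Finset.mem_Ioc]; omega)
      (fun n hn => by
        have := Finset.mem_Ioc.1 hn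
        exact ZMod.val_cast_of_lt (by omega))
      (fun u _ => Units.ext (ZMod.natCast_zmod_val _))
      (fun _ _ => rfl)
  rw [hbij, FiniteField.sum_pow_units, ZMod.card]

theorem modSum_mul (u v : Index) :
    modSum q u * modSum q v = ((stuffle u v).map (modSum q)).sum :=
  truncSum_mul (zinv q) (q - 1) zinv_add u v 0

theorem modSum_singleton {a : ℕ+} (ha : (a : ℕ) < q - 1) : modSum q [a] = 0 := by
  have e : modSum q [a] = ∑ n ∈ Finset.Ioc 0 (q - 1), (n : ZMod q) ^ (q - 1 - a) := by
    simp only [modSum, truncSum, mul_one]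
    refine Finset.sum_congr rfl fun n hn => ?_
    have := Finset.mem_Ioc.1 hn
    exact zinv_eq_pow ha.le (by omega) (by omega)
  rw [e, sum_Ioc_pow_zmod, if_neg]
  have := a.pos
  exact Nat.not_dvd_of_pos_of_lt (by omega) (by omega)

theorem modSum_reverse (u : Index) :
    modSum q u.reverse = (u.map fun a : ℕ+ => (-1 : ZMod q) ^ (a : ℕ)).prod * modSum q u := by
  have hq := (Fact.out : q.Prime).pos
  have h := truncSum_reverse (zinv q) (q := q) (fun a : ℕ+ => (-1 : ZMod q) ^ (a : ℕ))
    (fun a n _ hn => by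
      rw [zinv, zinv, Nat.cast_sub hn.le, ZMod.natCast_self, zero_sub, neg_pow, mul_inv,
        ← inv_pow, inv_neg_one]) u (M := 0) (N := q - 1) (by omega)
  rw [Nat.sub_zero, Nat.sub_self] at h
  exact h

/-- Modulo q this is the binomial coefficient of -a over b; the induction divides only by b + 1 < q.
-/
theorem mul_choose_sub_eq {a b : ℕ} (ha : 0 < a) (hb : a + b < q) :
    ((q - a).choose b : ZMod q) = (-1) ^ b * ((a + b - 1).choose b : ZMod q) := by
  induction b with
  | zero => simp
  | succ b ih =>
    have h1 := congrArg (Nat.cast : ℕ → ZMod q) (Nat.choose_succ_right_eq (q - a) b)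
    have h2 := congrArg (Nat.cast : ℕ → ZMod q) (Nat.add_one_mul_choose_eq (a + b - 1) b)
    rw [show a + b - 1 + 1 = a + b by omega] at h2
    rw [show q - a - b = q - (a + b) by omega] at h1
    push_cast [Nat.cast_sub (by omega : a + b ≤ q)] at h1 h2
    rw [ZMod.natCast_self, ih (by omega)] at h1
    have hb1 : ((b + 1 : ℕ) : ZMod q) ≠ 0 := natCast_ne_zero_of_lt (by omega) (by omega)
    rw [show a + (b + 1) - 1 = a + b by omega]
    refine mul_right_cancel₀ hb1 ?_
    push_cast
    rw [h1, pow_succ]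
    linear_combination -(-1) ^ b * h2

/-- The inner sum becomes a polynomial in n by Faulhaber, and multiplying by n^(q-1-b) leaves power
sums over the nonzero residues. -/
theorem modSum_pair {a b : ℕ+} (h : (a : ℕ) + b + 1 < q) :
    modSum q [a, b] = (-1) ^ (b : ℕ) * (((a : ℕ) + b).choose a : ZMod q) *
      (((bernoulli (q - (a + b)) : ℚ) : ZMod q) / (((a : ℕ) + b : ℕ) : ZMod q)) := by
  have ha0 := a.pos
  have hb0 := b.pos
  set e := q - 1 - a with he
  have hinv : ∀ n, 0 < n → n ≤ e + 1 → (n : ZMod q) ≠ 0 := fun n h0 hn =>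
    natCast_ne_zero_of_lt h0 (by omega)
  have inner : ∀ n ∈ Finset.Ioc 0 (q - 1), zinv q b n * truncSum (zinv q) (n - 1) [a] 0 =
      ∑ i ∈ Finset.range (e + 1), ((bernoulli i : ℚ) : ZMod q) * ((e + 1).choose i : ZMod q) /
        ((e + 1 : ℕ) : ZMod q) * (n : ZMod q) ^ (q - 1 - b + (e + 1 - i)) := by
    intro n hn
    have hn' := Finset.mem_Ioc.1 hn
    have e1 : truncSum (zinv q) (n - 1) [a] 0 = ∑ k ∈ Finset.range n, (k : ZMod q) ^ e := by
      simp only [truncSum, mul_one]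
      rw [Finset.sum_congr rfl fun m hm => zinv_eq_pow (by omega : (a : ℕ) ≤ q - 1)
        (by have := Finset.mem_Ioc.1 hm; omega : 0 < m)
        (by have := Finset.mem_Ioc.1 hm; omega : m < q)]
      refine Finset.sum_subset (fun m hm => ?_) fun m hm hm' => ?_
      · rw [Finset.mem_Ioc] at hm; rw [Finset.mem_range]; omega
      · rw [Finset.mem_Ioc] at hm'; rw [Finset.mem_range] at hm
        -- The added term m = 0 is harmless because e > 0.
        rw [show m = 0 by omega, Nat.cast_zero, zero_pow (by omega)]
    rw [e1, zinv_eq_pow (by omega) (by omega) (by omega), sum_range_pow_field hinv, Finset.mul_sum]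
    refine Finset.sum_congr rfl fun i _ => ?_
    rw [pow_add]; ring
  have e2 : modSum q [a, b] = ∑ i ∈ Finset.range (e + 1),
      ((bernoulli i : ℚ) : ZMod q) * ((e + 1).choose i : ZMod q) / ((e + 1 : ℕ) : ZMod q) *
        (if q - 1 ∣ q - 1 - b + (e + 1 - i) then -1 else 0) := by
    rw [modSum, show [a, b] = [a] ++ [b] from rfl, truncSum_append_singleton,
      Finset.sum_congr rfl inner, Finset.sum_comm]
    refine Finset.sum_congr rfl fun i _ => ?_
    rw [← Finset.mul_sum, sum_Ioc_pow_zmod]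
  have e3 : modSum q [a, b] = ((bernoulli (q - (a + b)) : ℚ) : ZMod q) *
      ((e + 1).choose (q - (a + b)) : ZMod q) / ((e + 1 : ℕ) : ZMod q) * (-1) := by
    -- The exponent is positive and below 2(q - 1), so q - 1 divides it only when it equals q - 1,
    -- which forces i = q - (a + b).
    rw [e2, Finset.sum_eq_single (q - (a + b))]
    · rw [if_pos]
      rw [show q - 1 - b + (e + 1 - (q - (a + b))) = q - 1 by omega]
    · intro i hi hne
      have hi' := Finset.mem_range.1 hi
      rw [if_neg, mul_zero]
      rintro ⟨c, hc⟩
      have hc1 : c ≠ 0 := by rintro rfl; omega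
      have hc2 : c < 2 := by
        by_contra hc2
        have := Nat.mul_le_mul_left (q - 1) (not_lt.1 hc2)
        omega
      have hc3 : c = 1 := by omega
      rw [hc3] at hc
      omega
    · intro hn
      exact absurd (Finset.mem_range.2 (by omega)) hn
  have hq0 : (q : ZMod q) = 0 := ZMod.natCast_self q
  have h4 : ((e + 1 : ℕ) : ZMod q) = -(a : ℕ) := by
    rw [show e + 1 = q - a by omega, Nat.cast_sub (by omega), hq0, zero_sub]
  have h5 : (e + 1).choose (q - (a + b)) = (q - a).choose b := by
    rw [show e + 1 = q - a by omega]
    exact Nat.choose_symm_of_eq_add (by omega)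
  have h6 := congrArg (Nat.cast : ℕ → ZMod q) (Nat.add_one_mul_choose_eq ((a : ℕ) + b - 1) (a - 1))
  rw [show (a : ℕ) + b - 1 + 1 = a + b by omega, show (a : ℕ) - 1 + 1 = a by omega,
    show ((a : ℕ) + b - 1).choose (a - 1) = ((a : ℕ) + b - 1).choose b from
      Nat.choose_symm_of_eq_add (by omega)] at h6
  have hA : ((a : ℕ) : ZMod q) ≠ 0 := natCast_ne_zero_of_lt ha0 (by omega)
  have hK : (((a : ℕ) + b : ℕ) : ZMod q) ≠ 0 := natCast_ne_zero_of_lt (by omega) (by omega)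
  rw [e3, h4, h5, mul_choose_sub_eq ha0 (by omega)]
  push_cast at h6 hK ⊢
  field_simp
  linear_combination ((bernoulli (q - (a + b)) : ℚ) : ZMod q) * h6

/-- Reversal makes the left side of the antipode relation 2 S(a,b,c), and all terms with a depth-one
factor vanish. The bound on q keeps every entry and the weight in the range of `modSum_singleton`
and `modSum_pair`. -/
theorem modSum_triple {a b c : ℕ+} (hodd : Odd ((a : ℕ) + b + c)) (h : (a : ℕ) + b + c + 1 < q) :
    2 * modSum q [a, b, c] = ((-1) ^ (a : ℕ) * (((a : ℕ) + b + c).choose a : ZMod q) -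
      (-1) ^ (c : ℕ) * (((a : ℕ) + b + c).choose c : ZMod q)) *
      (((bernoulli (q - (a + b + c)) : ℚ) : ZMod q) / (((a : ℕ) + b + c : ℕ) : ZMod q)) ∧
    modSum q [a, b, c] + ((contractions [a, b, c]).map (modSum q)).sum = 0 := by
  have anti := antipode_of_stuffle (modSum q) modSum_mul a b c
  have hrev := modSum_reverse (q := q) [a, b, c]
  simp only [List.reverse_cons, List.reverse_nil, List.nil_append, List.cons_append, List.map_cons,
    List.map_nil, List.prod_cons, List.prod_nil, mul_one, ← pow_add] at hrev
  rw [← add_assoc, hodd.neg_one_pow] at hrev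
  have hcb : ((c + b : ℕ+) : ℕ) = c + b := PNat.add_coe _ _
  have hba : ((b + a : ℕ+) : ℕ) = b + a := PNat.add_coe _ _
  have hab : ((a + b : ℕ+) : ℕ) = a + b := PNat.add_coe _ _
  have hbc : ((b + c : ℕ+) : ℕ) = b + c := PNat.add_coe _ _
  have s1 : modSum q [a] = 0 := modSum_singleton (by omega)
  have s2 : modSum q [c] = 0 := modSum_singleton (by omega)
  have s3 : modSum q [a + b + c] = 0 := modSum_singleton (by rw [PNat.add_coe, hab]; omega)
  have p1 := modSum_pair (q := q) (a := c + b) (b := a) (by omega)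
  have p2 := modSum_pair (q := q) (a := c) (b := b + a) (by omega)
  have p3 := modSum_pair (q := q) (a := a) (b := b + c) (by omega)
  have p4 := modSum_pair (q := q) (a := a + b) (b := c) (by omega)
  rw [Nat.choose_symm_add, hcb, show (c : ℕ) + b + a = a + b + c by ring] at p1
  rw [hba, show (c : ℕ) + (b + a) = a + b + c by ring,
    neg_one_pow_eq_of_odd_add (by rw [show (b : ℕ) + a + c = a + b + c by ring]; exact hodd)] at p2
  rw [hbc, ← add_assoc (a : ℕ),
    neg_one_pow_eq_of_odd_add (by rw [show (b : ℕ) + c + a = a + b + c by ring]; exact hodd)] at p3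
  rw [Nat.choose_symm_add, hab] at p4
  rw [s1, s2, s3] at anti
  have key : 2 * modSum q [a, b, c] = ((-1) ^ (a : ℕ) * (((a : ℕ) + b + c).choose a : ZMod q) -
      (-1) ^ (c : ℕ) * (((a : ℕ) + b + c).choose c : ZMod q)) *
      (((bernoulli (q - (a + b + c)) : ℚ) : ZMod q) / (((a : ℕ) + b + c : ℕ) : ZMod q)) := by
    linear_combination anti + hrev + p1 + p2
  refine ⟨key, ?_⟩
  simp only [contractions, List.map_cons, List.map_nil, List.cons_append, List.nil_append,
    List.sum_cons, List.sum_nil, s3]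
  linear_combination key + p3 + p4

end

/-! ### The `𝒜`-values -/

theorem zetaA_one_eq (k : Index) : zetaA 1 k = toA 1 fun p => modSum ((p : ℕ) ^ 1) k := by
  unfold zetaA
  congr 1
  funext p
  have hp : Finset.Ioo 0 (p : ℕ) = Finset.Ioc 0 ((p : ℕ) ^ 1 - 1) := by
    ext n
    have := p.2.pos
    rw [Finset.mem_Ioo, Finset.mem_Ioc, pow_one]
    omega
  rw [hp]
  exact sum_strictMono_eq_truncSum (zinv ((p : ℕ) ^ 1)) _ k 0 _

/-- The components of 𝒜₁ have modulus `p ^ 1` literally; taking q = p ^ 1 avoids any transport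
between rings. -/
theorem fact_prime_pow_one (p : Nat.Primes) : Fact ((p : ℕ) ^ 1).Prime :=
  ⟨by rw [pow_one]; exact p.2⟩

theorem zetaAStar_one_eq (k : Index) :
    zetaAStar 1 k = toA 1 fun p => ((contractions k).map (modSum ((p : ℕ) ^ 1))).sum := by
  unfold zetaAStar
  congr 1
  funext p
  have := fact_prime_pow_one p
  have hp : Finset.Icc 1 ((p : ℕ) - 1) = Finset.Ioc 0 ((p : ℕ) ^ 1 - 1) := by
    rw [pow_one]; rfl
  rw [hp]
  exact (sum_monotone_eq_truncStar (zinv ((p : ℕ) ^ 1)) _ k 0 _).trans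
    (truncStar_eq_sum_contractions _ _ zinv_add k 0)

theorem ratMod_bernoulli_div {q K : ℕ} [Fact q.Prime] (hK : 2 ≤ K) (h : K < q) :
    ratMod q (bernoulli (q - K) / (K : ℚ)) =
      ((bernoulli (q - K) : ℚ) : ZMod q) / (K : ZMod q) := by
  have h1 := (reduces_bernoulli (F := ZMod q) (N := q - 2)
    (fun n h0 hn => natCast_ne_zero_of_lt h0 (by omega)) (by omega : q - K ≤ q - 2)).div_nat
    (natCast_ne_zero_of_lt (by omega : 0 < K) h)
  rw [← h1.2, Rat.cast_def, div_eq_mul_inv]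
  rfl

theorem toA_add (n : ℕ) (f g : ∀ p : Nat.Primes, ZMod ((p : ℕ) ^ n)) :
    toA n f + toA n g = toA n (f + g) := rfl

theorem toA_mul (n : ℕ) (f g : ∀ p : Nat.Primes, ZMod ((p : ℕ) ^ n)) :
    toA n f * toA n g = toA n (f * g) := rfl

theorem toA_zero (n : ℕ) : toA n 0 = 0 := rfl

theorem toA_intCast (n : ℕ) (m : ℤ) : (m : ARing n) = toA n m := rfl

/-- The case `𝓕 = 𝓐` of the theorem. -/
theorem zetaA_one_triple {a b c : ℕ+} (h : Odd ((a + b + c : ℕ+) : ℕ)) :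
    zetaA 1 [a, b, c] = -zetaAStar 1 [a, b, c] ∧
      -zetaAStar 1 [a, b, c] =
        ((1 / 2 : ℚ) * ((-1) ^ (a : ℕ) * (((a + b + c : ℕ+) : ℕ).choose a : ℚ) -
          (-1) ^ (c : ℕ) * (((a + b + c : ℕ+) : ℕ).choose c : ℚ))) • frakZA 1 (a + b + c) := by
  have hKe : ((a + b + c : ℕ+) : ℕ) = a + b + c := by rw [PNat.add_coe, PNat.add_coe]
  rw [hKe] at h ⊢
  have ha := a.pos
  have hb := b.pos
  have hbig : ∀ p : Nat.Primes, ¬ (p : ℕ) ∣ ((a : ℕ) + b + c + 1).factorial →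
      (a : ℕ) + b + c + 1 < (p : ℕ) ^ 1 := fun p hp => by
    rw [pow_one]
    exact not_le.1 fun hle => hp ((p.2.dvd_factorial).2 hle)
  have e1 : zetaA 1 [a, b, c] = -zetaAStar 1 [a, b, c] := by
    rw [eq_neg_iff_add_eq_zero, zetaA_one_eq, zetaAStar_one_eq, toA_add, ← toA_zero]
    -- The factorial discards exactly the primes p ≤ k + 1.
    refine toA_eq_of_dvd (((a : ℕ) + b + c + 1).factorial) (Nat.factorial_ne_zero _) fun p hp => ?_
    have := fact_prime_pow_one p
    exact (modSum_triple h (hbig p hp)).2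
  refine ⟨e1, ?_⟩
  rw [← e1]
  have h2 := eq_half_smul (x := zetaA 1 [a, b, c]) (y := frakZA 1 (a + b + c))
    ((-1) ^ (a : ℕ) * (((a : ℕ) + b + c).choose a : ℤ) -
      (-1) ^ (c : ℕ) * (((a : ℕ) + b + c).choose c : ℤ)) (by
    rw [zetaA_one_eq, frakZA, toA_intCast, toA_mul, show (2 : ARing 1) = toA 1 2 from rfl, toA_mul]
    refine toA_eq_of_dvd (((a : ℕ) + b + c + 1).factorial) (Nat.factorial_ne_zero _) fun p hp => ?_
    have := fact_prime_pow_one p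
    have hlt := hbig p hp
    -- For n = 1 the Bernoulli index p - 1 + 1 - k is p - k, and the denominator k - 1 + 1 is k.
    have e3 : bernoulli ((p : ℕ) ^ (1 - 1) * ((p : ℕ) - 1) + 1 - ((a + b + c : ℕ+) : ℕ)) /
        ((((a + b + c : ℕ+) : ℕ) : ℚ) - 1 + (p : ℚ) ^ (1 - 1)) =
        bernoulli ((p : ℕ) ^ 1 - (a + b + c)) / (((a : ℕ) + b + c : ℕ) : ℚ) := by
      rw [pow_one] at hlt
      rw [hKe, Nat.sub_self, pow_zero, pow_zero, one_mul, sub_add_cancel, pow_one,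
        Nat.sub_add_cancel p.2.pos]
    simp only [Pi.mul_apply]
    rw [e3, ratMod_bernoulli_div (by omega) (by omega)]
    refine (modSum_triple h hlt).1.trans ?_
    congr 1
    simp)
  push_cast at h2
  exact h2

end FiniteMZV

theorem mainTheorem12 (k₁ k₂ k₃ : ℕ+) (hodd : Odd ((k₁ + k₂ + k₃ : ℕ+) : ℕ)) :
    (FiniteMZV.zetaA 1 [k₁, k₂, k₃] = -FiniteMZV.zetaAStar 1 [k₁, k₂, k₃] ∧
      -FiniteMZV.zetaAStar 1 [k₁, k₂, k₃] =
        ((1 / 2 : ℚ) *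
          ((-1) ^ (k₁ : ℕ) * (((k₁ + k₂ + k₃ : ℕ+) : ℕ).choose k₁ : ℚ) -
            (-1) ^ (k₃ : ℕ) * (((k₁ + k₂ + k₃ : ℕ+) : ℕ).choose k₃ : ℚ))) •
          FiniteMZV.frakZA 1 (k₁ + k₂ + k₃)) ∧
    (FiniteMZV.zetaS 1 [k₁, k₂, k₃] = -FiniteMZV.zetaSStar 1 [k₁, k₂, k₃] ∧
      -FiniteMZV.zetaSStar 1 [k₁, k₂, k₃] =
        ((1 / 2 : ℚ) *
          ((-1) ^ (k₁ : ℕ) * (((k₁ + k₂ + k₃ : ℕ+) : ℕ).choose k₁ : ℚ) -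
            (-1) ^ (k₃ : ℕ) * (((k₁ + k₂ + k₃ : ℕ+) : ℕ).choose k₃ : ℚ))) •
          FiniteMZV.frakZS 1 (k₁ + k₂ + k₃)) :=
  ⟨FiniteMZV.zetaA_one_triple hodd, FiniteMZV.zetaS_one_triple hodd⟩
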